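/- **Model.** $T=(V,E,w)$ is a finite tree with edge weights $w:E\to\mathbb R_{>0}$ and a homebase $r\in V$, and $q\ge 0$ is the invoking cost. Initially no agent is present. A strategy is a finite sequence of moves; one move either invokes a new agent in $r$, or lets one agent already present traverse an edge incident to the vertex that it occupies. It explores $T$ if every vertex (including $r$) is visited by some agent; agents need not return to $r$. Its cost is $kq+\sum_{i=1}^k d_i$, where $k$ is the number of invoked agents and $d_i$ the distance traversed by the $i$-th one. $\mathcal S^{opt}_q(T)$ denotes the minimum cost of a strategy that explores $T$ (the off-line optimum). An on-line strategy $\mathcal S$ is a deterministic rule that determines the next move (or the end of the strategy) from the information obtained so far, namely the past moves together with, for each vertex visited so far, its incident edges, their weights and the names of their other ends; it has to explore every tree $T$ (for every homebase). $\mathcal S_q(T)$ is its cost on $T$, and $r_q(\mathcal S)=\sup_T \mathcal S_q(T)/\mathcal S^{opt}_q(T)$ its competitive ratio (with $0/0=0$, which only concerns the one-vertex tree with $q=0$). $DFS'$ is depth-first search by a single agent that stops as soon as all vertices are explored: the agent goes to an arbitrary unexplored neighbour of its current vertex if there is one, and otherwise back to the parent of the current vertex. For an integer $l\ge 1$ let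 $\mathcal T_l$ be the class of trees with all edge weights $1$ that consist of a path (spine) of length $l(l+1)$ starting in the homebase $v_0$, and, for each $i\in\{1,\dots,l\}$, of a side path of some length $l_i\in\{1,\dots,l\}$ attached to the vertex $v_i$ of the spine at distance $il$ from $v_0$. **Theorem.** Let $q\ge 0$. 1. $DFS'$ (with every rule for the choice among unexplored neighbours) is an on-line strategy with $r_q(DFS')\le 2$. 2. For every $\varepsilon>0$ there is an $L$ (depending only on $q$ and $\varepsilon$) such that for every $l\ge L$ and every on-line strategy $\mathcal S$ there is a tree $T\in\mathcal T_l$ with $\mathcal S_q(T)\ge(2-\varepsilon)\,\mathcal S^{opt}_q(T)$. 3. Consequently the least competitive ratio of an on-line strategy for trees is exactly $2$: every on-line strategy $\mathcal S$ has $r_q(\mathcal S)\ge 2$, and equality is attained. -/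

import Mathlib

open scoped ENNReal

/-- A finite edge-weighted tree with positive real weights and a distinguished homebase (the root).
Vertices are named by natural numbers; `tree` is a subgraph of the complete graph on `ℕ`. -/
structure WTree where
  tree : (⊤ : SimpleGraph ℕ).Subgraph
  finite : tree.verts.Finite
  isTree : tree.coe.IsTree
  weight : Sym2 ℕ → ℝ
  weight_pos : ∀ e ∈ tree.edgeSet, 0 < weight e
  home : ℕ
  home_mem : home ∈ tree.verts

/-- A move: invoking a new agent in the homebase, or the traversal by agent `a` of the edge from
its current vertex to the adjacent vertex `v`. Agents are numbered `0, 1, 2, …` in the order in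
which they are invoked. One move is made per step. -/
inductive Move where
  | invoke : Move
  | traverse (a v : ℕ) : Move

/-- `Legal T pos ms`: the moves `ms` can be performed on `T`, one after another, when agent `a`
occupies `pos[a]` at the beginning. -/
def Legal (T : WTree) : List ℕ → List Move → Prop
  | _, [] => True
  | pos, Move.invoke :: ms => Legal T (pos ++ [T.home]) ms
  | pos, Move.traverse a v :: ms =>
      (∃ u, pos[a]? = some u ∧ T.tree.Adj u v) ∧ Legal T (pos.set a v) ms

/-- The total distance traversed by all agents during `ms`, when agent `a` occupies `pos[a]` at
the beginning. (The value `0` for an agent that was not invoked is never used for legal moves.) -/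
noncomputable def totalDistance (T : WTree) : List ℕ → List Move → ℝ
  | _, [] => 0
  | pos, Move.invoke :: ms => totalDistance T (pos ++ [T.home]) ms
  | pos, Move.traverse a v :: ms =>
      (match pos[a]? with
        | some u => T.weight s(u, v)
        | none => 0) + totalDistance T (pos.set a v) ms

/-- The number of agents invoked by a sequence of moves. -/
def numAgents : List Move → ℕ
  | [] => 0
  | Move.invoke :: ms => numAgents ms + 1
  | Move.traverse _ _ :: ms => numAgents ms

/-- The cost: the invoking cost `q` for each agent, plus the total distance. -/
noncomputable def cost (q : ℝ) (T : WTree) (ms : List Move) : ℝ :=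
  (numAgents ms : ℝ) * q + totalDistance T [] ms

/-- The vertex of `T` reached by a move. -/
def reached (T : WTree) : Move → ℕ
  | Move.invoke => T.home
  | Move.traverse _ v => v

/-- `ms` is an (off-line) exploration strategy for `T`: a legal sequence of moves, starting with no
agent present, such that each vertex is visited by some agent. -/
def Explores (T : WTree) (ms : List Move) : Prop :=
  Legal T [] ms ∧ ∀ x ∈ T.tree.verts, ∃ m ∈ ms, reached T m = x

/-- The cost of a cost-optimal off-line strategy for `T`. -/
noncomputable def optCost (q : ℝ) (T : WTree) : ℝ :=
  sInf {c : ℝ | ∃ ms, Explores T ms ∧ cost q T ms = c}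

/-- What becomes known with one move: the move itself, the vertex reached by it, and the edges
incident to this vertex, each given as the name of the other end and the length. -/
structure Event where
  move : Move
  vertex : ℕ
  star : Set (ℕ × ℝ)

/-- The information obtained on `T` by a move. -/
def observe (T : WTree) (m : Move) : Event where
  move := m
  vertex := reached T m
  star := {p | T.tree.Adj (reached T m) p.1 ∧ p.2 = T.weight s(reached T m, p.1)}

/-- All the information available after the moves `ms` on `T` (agents communicate freely). -/
def history (T : WTree) (ms : List Move) : List Event := ms.map (observe T)

/-- The decision rule `next` (`none` means stop), applied on the unknown tree `T`, performs exactly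
the moves `ms` and then stops. -/
def Performs (next : List Event → Option Move) (T : WTree) (ms : List Move) : Prop :=
  (∀ (i : ℕ) (hi : i < ms.length), next (history T (ms.take i)) = some ms[i]) ∧
    next (history T ms) = none

/-- A deterministic on-line strategy for trees: each decision is a function of the information
collected so far, and every tree is explored. -/
structure OnlineStrategy where
  next : List Event → Option Move
  explores : ∀ T : WTree, ∃ ms, Performs next T ms ∧ Explores T ms

/-- The moves performed by an on-line strategy on `T`. -/
noncomputable def OnlineStrategy.moves (S : OnlineStrategy) (T : WTree) : List Move :=
  (S.explores T).choose

/-- The cost of an on-line strategy on `T`. -/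
noncomputable def OnlineStrategy.costOn (S : OnlineStrategy) (q : ℝ) (T : WTree) : ℝ :=
  cost q T (S.moves T)

/-- The competitive ratio, the supremum over all trees of on-line cost over optimal cost. The
optimal cost vanishes only if `q = 0` and `T` has one vertex; then the on-line cost vanishes too, and
`0 / 0 = 0` in `ℝ≥0∞`. -/
noncomputable def competitiveRatio (q : ℝ) (S : OnlineStrategy) : ℝ≥0∞ :=
  ⨆ T : WTree, ENNReal.ofReal (S.costOn q T) / ENNReal.ofReal (optCost q T)

/-- The vertex `x` was visited during `h`. -/
def Visited (h : List Event) (x : ℕ) : Prop := ∃ e ∈ h, e.vertex = x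

/-- `p` is the vertex from which the agent that makes the walk `h` entered `c` for the first
time. -/
def IsDFSParent (h : List Event) (c p : ℕ) : Prop :=
  ∃ (h₁ h₂ : List Event) (e₁ e₂ : Event), h = h₁ ++ e₁ :: e₂ :: h₂ ∧
    e₁.vertex = p ∧ e₂.vertex = c ∧ ¬ Visited (h₁ ++ [e₁]) c

/-- Depth-first search by one agent without the return to the homebase: the agent goes to an
unvisited neighbour of its vertex if there is one (any of them); otherwise it goes back to the parent,
or stops at once if no known vertex is unvisited. -/
def IsDFSWithoutReturn (next : List Event → Option Move) : Prop :=
  next [] = some Move.invoke ∧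
  ∀ (h : List Event) (e : Event),
    ((∃ p ∈ e.star, ¬ Visited (h ++ [e]) p.1) →
      ∃ p ∈ e.star, ¬ Visited (h ++ [e]) p.1 ∧ next (h ++ [e]) = some (Move.traverse 0 p.1)) ∧
    ((∀ p ∈ e.star, Visited (h ++ [e]) p.1) →
      (∃ f ∈ h, ∃ p ∈ f.star, ¬ Visited (h ++ [e]) p.1) →
      ∀ u, IsDFSParent (h ++ [e]) e.vertex u → next (h ++ [e]) = some (Move.traverse 0 u)) ∧
    ((∀ f ∈ h ++ [e], ∀ p ∈ f.star, Visited (h ++ [e]) p.1) → next (h ++ [e]) = none)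

/-- A spine `0, 1, …, l (l + 1)`, and for each `i < l` a side path with `len i` vertices. -/
abbrev SpineVertex (l : ℕ) (len : Fin l → ℕ) : Type :=
  Fin (l * (l + 1) + 1) ⊕ (Σ i : Fin l, Fin (len i))

/-- Consecutive vertices of the spine and of each side path are adjacent, and the first vertex of
the side path `i` is adjacent to the vertex `(i + 1) l` of the spine. -/
def spineGraph (l : ℕ) (len : Fin l → ℕ) : SimpleGraph (SpineVertex l len) :=
  SimpleGraph.fromRel fun x y =>
    match x, y with
    | Sum.inl s, Sum.inl t => (s : ℕ) + 1 = t
    | Sum.inl s, Sum.inr ⟨i, j⟩ => (s : ℕ) = ((i : ℕ) + 1) * l ∧ (j : ℕ) = 0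
    | Sum.inr ⟨i, j⟩, Sum.inr ⟨i', j'⟩ => i = i' ∧ (j : ℕ) + 1 = j'
    | Sum.inr _, Sum.inl _ => False

/-- `T` is a unit-weight tree that consists of a spine of `l + 1` segments of length `l`, with the
homebase at one end, and of one side path of length between `1` and `l` at each of the `l` vertices
where two segments meet. -/
def IsSpineTree (l : ℕ) (T : WTree) : Prop :=
  1 ≤ l ∧ ∃ len : Fin l → ℕ, (∀ i, 1 ≤ len i ∧ len i ≤ l) ∧
    (∃ φ : spineGraph l len ≃g T.tree.coe, ((φ (Sum.inl 0) : T.tree.verts) : ℕ) = T.home) ∧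
    ∀ e ∈ T.tree.edgeSet, T.weight e = 1

/-!
*Upper bound.* A depth-first search uses one agent and crosses every edge at most twice, whereas
every strategy that explores the tree invokes an agent and crosses every edge at least once.

*Lower bound.* At each branching vertex the adversary hides which of two branches, identical so far,
continues the spine. It decides as soon as both branches are occupied or one of them is explored to
depth `l`: the branch that is empty just before that move becomes the side branch, and it ends one
vertex beyond its explored part. Hence every edge of the side branch is crossed at least three
times, and four times unless an agent ends there, in which case that agent has crossed the first
spine segment, of length `l`, an additional time. Moreover all but at most one of the spine segments
are crossed twice, since either two agents get beyond the segment or somebody comes back. If `K` is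
the total length of the side paths, the strategy therefore costs at least `2 l² + 4 K - O(l)`, while
a single agent needs at most `q + l (l + 1) + 2 K`.
-/

/-! ### Rooted trees described by parent functions -/

section Rootings

variable {V : Type*} {G : SimpleGraph V} {r : V} {par : V → V} {rk : V → ℕ}

/-- `par` is the parent function of the graph `G` rooted at `r`: the edges of `G` join each vertex
`v ≠ r` to `par v`. The rank `rk`, which decreases along `par`, makes the ascent from a vertex end
in `r`. By convention the root is its own parent. -/
structure IsRooting (G : SimpleGraph V) (r : V) (par : V → V) (rk : V → ℕ) : Prop where
  par_root : par r = r
  rk_lt : ∀ v, v ≠ r → rk (par v) < rk v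
  adj_iff : ∀ u v, G.Adj u v ↔ (v ≠ r ∧ par v = u) ∨ (u ≠ r ∧ par u = v)

theorem exists_adj_dist_add_one_eq (hG : G.Connected) {v : V} (hv : v ≠ r) :
    ∃ u, G.Adj u v ∧ G.dist r u + 1 = G.dist r v := by
  obtain ⟨p, hp⟩ := hG.exists_walk_length_eq_dist r v
  have hnil : ¬ p.Nil := fun h => hv h.eq.symm
  refine ⟨p.penultimate, p.adj_penultimate hnil, le_antisymm ?_ ?_⟩
  · rw [← hp, ← SimpleGraph.Walk.length_dropLast_add_one hnil]
    exact Nat.succ_le_succ (SimpleGraph.dist_le _)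
  · rw [← SimpleGraph.dist_eq_one_iff_adj.2 (p.adj_penultimate hnil)]
    exact hG.dist_triangle

theorem eq_of_adj_of_dist_add_one_eq (hG : G.IsTree) {u u' v : V} (hu : G.Adj u v)
    (hu' : G.Adj u' v) (hd : G.dist r u + 1 = G.dist r v) (hd' : G.dist r u' + 1 = G.dist r v) :
    u = u' := by
  have exists_path : ∀ w, G.Adj w v → G.dist r w + 1 = G.dist r v →
      ∃ p : G.Walk r v, p.IsPath ∧ p.penultimate = w := by
    intro w hw hdw
    obtain ⟨p, hp⟩ := hG.connected.exists_walk_length_eq_dist r w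
    refine ⟨p.concat hw, SimpleGraph.Walk.isPath_of_length_eq_dist _ ?_,
      SimpleGraph.Walk.penultimate_concat _ _⟩
    rw [SimpleGraph.Walk.length_concat, hp, hdw]
  obtain ⟨p, hp, rfl⟩ := exists_path u hu hd
  obtain ⟨p', hp', rfl⟩ := exists_path u' hu' hd'
  rw [(hG.existsUnique_path r v).unique hp hp']

theorem exists_isRooting (hG : G.IsTree) (r : V) : ∃ par rk, IsRooting G r par rk := by
  classical
  choose p hadj hdist using fun v (hv : v ≠ r) => exists_adj_dist_add_one_eq hG.connected hv
  have par_eq : ∀ u v (hv : v ≠ r), G.Adj u v → G.dist r v = G.dist r u + 1 → p v hv = u :=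
    fun u v hv huv hd => eq_of_adj_of_dist_add_one_eq hG (hadj v hv) huv (hdist v hv) hd.symm
  have ne_root : ∀ u v, G.dist r v = G.dist r u + 1 → v ≠ r := by
    rintro u v hd rfl
    simp at hd
  refine ⟨fun v => if hv : v = r then r else p v hv, G.dist r, dif_pos rfl, fun v hv => ?_,
    fun u v => ⟨fun huv => ?_, ?_⟩⟩
  · rw [dif_neg hv, ← hdist v hv]
    exact Nat.lt_succ_self _
  · refine (hG.dist_eq_dist_add_one_of_adj r huv).symm.imp (fun hd => ?_) (fun hd => ?_)
    · exact ⟨ne_root u v hd, (dif_neg (ne_root u v hd)).trans (par_eq u v _ huv hd)⟩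
    · exact ⟨ne_root v u hd, (dif_neg (ne_root v u hd)).trans (par_eq v u _ huv.symm hd)⟩
  · rintro (⟨hv, rfl⟩ | ⟨hu, rfl⟩)
    · rw [dif_neg hv]
      exact hadj v hv
    · rw [dif_neg hu]
      exact (hadj u hu).symm

namespace IsRooting

theorem connected (h : IsRooting G r par rk) : G.Connected := by
  have reachable_root : ∀ n v, rk v = n → G.Reachable v r := by
    intro n
    induction n using Nat.strong_induction_on with
    | _ n ih =>
      rintro v rfl
      by_cases hv : v = r
      · rw [hv]
      · exact ((h.adj_iff v (par v)).2 (Or.inr ⟨hv, rfl⟩)).reachable.trans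
          (ih _ (h.rk_lt v hv) _ rfl)
  have : Nonempty V := ⟨r⟩
  exact SimpleGraph.Connected.mk fun u v =>
    (reachable_root _ u rfl).trans (reachable_root _ v rfl).symm

theorem isTree [Finite V] (h : IsRooting G r par rk) : G.IsTree := by
  classical
  let parentEdge : ({r}ᶜ : Set V) → G.edgeSet := fun v =>
    ⟨s(par v, v), (h.adj_iff _ _).2 (Or.inl ⟨v.2, rfl⟩)⟩
  have parentEdge_surjective : Function.Surjective parentEdge := by
    rintro ⟨⟨x, y⟩, he⟩
    obtain ⟨hy, hpar⟩ | ⟨hx, hpar⟩ := (h.adj_iff x y).1 he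
    · exact ⟨⟨y, hy⟩, Subtype.ext (congrArg (s(·, y)) hpar)⟩
    · exact ⟨⟨x, hx⟩, Subtype.ext ((congrArg (s(·, x)) hpar).trans Sym2.eq_swap)⟩
  have card_edges := Nat.card_le_card_of_surjective parentEdge parentEdge_surjective
  have card_compl : Nat.card ({r}ᶜ : Set V) + 1 = Nat.card V := by
    rw [← Set.ncard_add_ncard_compl {r}, Set.ncard_singleton, add_comm]
    rfl
  refine SimpleGraph.isTree_iff_connected_and_card.2
    ⟨h.connected, le_antisymm ?_ h.connected.card_vert_le_card_edgeSet_add_one⟩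
  omega

end IsRooting

end Rootings

/-- The counterpart of `IsRooting` for the tree `T` with its homebase as the root; the parent
function is defined on all names of vertices. -/
structure RootedBy (T : WTree) (par rk : ℕ → ℕ) : Prop where
  par_home : par T.home = T.home
  par_mem : ∀ v ∈ T.tree.verts, par v ∈ T.tree.verts
  rk_lt : ∀ v ∈ T.tree.verts, v ≠ T.home → rk (par v) < rk v
  adj_iff : ∀ u v, T.tree.Adj u v ↔ u ∈ T.tree.verts ∧ v ∈ T.tree.verts ∧
    ((v ≠ T.home ∧ par v = u) ∨ (u ≠ T.home ∧ par u = v))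

theorem WTree.exists_rootedBy (T : WTree) : ∃ par rk, RootedBy T par rk := by
  classical
  obtain ⟨p, rk, h⟩ := exists_isRooting T.isTree ⟨T.home, T.home_mem⟩
  let par : ℕ → ℕ := fun v => if hv : v ∈ T.tree.verts then p ⟨v, hv⟩ else v
  have par_coe : ∀ v : T.tree.verts, par v = p v := fun v => dif_pos v.2
  let rank : ℕ → ℕ := fun v => if hv : v ∈ T.tree.verts then rk ⟨v, hv⟩ else 0
  have rank_coe : ∀ v : T.tree.verts, rank v = rk v := fun v => dif_pos v.2
  refine ⟨par, rank, ⟨?_, fun v hv => ?_, fun v hv hne => ?_, fun u v => ?_⟩⟩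
  · exact (par_coe ⟨T.home, T.home_mem⟩).trans (congrArg Subtype.val h.par_root)
  · exact par_coe ⟨v, hv⟩ ▸ (p ⟨v, hv⟩).2
  · have := h.rk_lt ⟨v, hv⟩ (fun heq => hne (congrArg Subtype.val heq))
    rwa [← rank_coe, ← rank_coe ⟨v, hv⟩, ← par_coe] at this
  · by_cases huv : u ∈ T.tree.verts ∧ v ∈ T.tree.verts
    · obtain ⟨hu, hv⟩ := huv
      have := h.adj_iff ⟨u, hu⟩ ⟨v, hv⟩
      simpa only [hu, hv, true_and, SimpleGraph.Subgraph.coe_adj, Ne, Subtype.ext_iff,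
        ← par_coe] using this
    · exact ⟨fun hadj => (huv ⟨T.tree.edge_vert hadj, T.tree.edge_vert hadj.symm⟩).elim,
        fun hadj => (huv ⟨hadj.1, hadj.2.1⟩).elim⟩

/-- The subgraph with vertex set `V` in which each vertex other than `home` is joined to its
parent. -/
def parentSubgraph (V : Set ℕ) (home : ℕ) (par : ℕ → ℕ) (hpar : ∀ v ∈ V, v ≠ home → par v ≠ v) :
    (⊤ : SimpleGraph ℕ).Subgraph where
  verts := V
  Adj u v := u ∈ V ∧ v ∈ V ∧ ((v ≠ home ∧ par v = u) ∨ (u ≠ home ∧ par u = v))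
  adj_sub := by
    rintro u v ⟨hu, hv, ⟨h, rfl⟩ | ⟨h, rfl⟩⟩
    · exact hpar v hv h
    · exact (hpar u hu h).symm
  edge_vert := fun h => h.1
  symm := ⟨fun _ _ ⟨hu, hv, h⟩ => ⟨hv, hu, h.symm⟩⟩

theorem parentSubgraph_isTree {V : Set ℕ} {home : ℕ} {par rk : ℕ → ℕ} (hV : V.Finite)
    (hhome : home ∈ V) (hmem : ∀ v ∈ V, par v ∈ V) (hrk : ∀ v ∈ V, v ≠ home → rk (par v) < rk v)
    (hpar : par home = home) (hne : ∀ v ∈ V, v ≠ home → par v ≠ v) :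
    (parentSubgraph V home par hne).coe.IsTree := by
  have : Finite (parentSubgraph V home par hne).verts := hV
  have : IsRooting (parentSubgraph V home par hne).coe ⟨home, hhome⟩
      (fun v => ⟨par v, hmem v v.2⟩) (fun v => rk v) :=
    { par_root := Subtype.ext hpar
      rk_lt := fun v hv => hrk v v.2 (fun h => hv (Subtype.ext h))
      adj_iff := by
        rintro ⟨u, hu⟩ ⟨v, hv⟩
        simp only [SimpleGraph.Subgraph.coe_adj, Ne, Subtype.ext_iff]
        exact ⟨fun h => h.2.2, fun h => ⟨hu, hv, h⟩⟩ }
  exact this.isTree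

/-- The unit-weight tree with a given parent function. -/
noncomputable def WTree.ofParent (V : Set ℕ) (home : ℕ) (par rk : ℕ → ℕ) (hV : V.Finite)
    (hhome : home ∈ V) (hmem : ∀ v ∈ V, par v ∈ V)
    (hrk : ∀ v ∈ V, v ≠ home → rk (par v) < rk v) (hpar : par home = home) : WTree where
  tree := parentSubgraph V home par fun v hv hne h => (hrk v hv hne).ne (congrArg rk h)
  finite := hV
  isTree := parentSubgraph_isTree hV hhome hmem hrk hpar _
  weight := fun _ => 1
  weight_pos := fun _ _ => one_pos
  home := home
  home_mem := hhome

theorem WTree.ofParent_rootedBy {V : Set ℕ} {home : ℕ} {par rk : ℕ → ℕ} (hV : V.Finite)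
    (hhome : home ∈ V) (hmem : ∀ v ∈ V, par v ∈ V)
    (hrk : ∀ v ∈ V, v ≠ home → rk (par v) < rk v) (hpar : par home = home) :
    RootedBy (WTree.ofParent V home par rk hV hhome hmem hrk hpar) par rk where
  par_home := hpar
  par_mem := hmem
  rk_lt := hrk
  adj_iff := fun _ _ => Iff.rfl

/-! ### Positions, visited vertices and edge crossings -/

/-- The positions of the agents after the moves `ms`, when agent `a` occupies `pos[a]` at the
beginning. -/
def endPos (home : ℕ) : List ℕ → List Move → List ℕ
  | pos, [] => pos
  | pos, Move.invoke :: ms => endPos home (pos ++ [home]) ms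
  | pos, Move.traverse a v :: ms => endPos home (pos.set a v) ms

/-- The number of traversals of the edge `e` during the moves `ms`. -/
def crossings (home : ℕ) (e : Sym2 ℕ) : List ℕ → List Move → ℕ
  | _, [] => 0
  | pos, Move.invoke :: ms => crossings home e (pos ++ [home]) ms
  | pos, Move.traverse a v :: ms =>
      (if (pos[a]?).map (fun u => s(u, v)) = some e then 1 else 0) +
        crossings home e (pos.set a v) ms

/-- The set of the vertices visited during the moves `ms`. -/
def visitedVerts (T : WTree) (ms : List Move) : Finset ℕ := (ms.map (reached T)).toFinset

theorem endPos_append (home : ℕ) (pos : List ℕ) (m₁ m₂ : List Move) :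
    endPos home pos (m₁ ++ m₂) = endPos home (endPos home pos m₁) m₂ := by
  induction m₁ generalizing pos with
  | nil => rfl
  | cons m ms ih => cases m <;> simp [endPos, ih]

theorem crossings_append (home : ℕ) (e : Sym2 ℕ) (pos : List ℕ) (m₁ m₂ : List Move) :
    crossings home e pos (m₁ ++ m₂) =
      crossings home e pos m₁ + crossings home e (endPos home pos m₁) m₂ := by
  induction m₁ generalizing pos with
  | nil => simp [crossings, endPos]
  | cons m ms ih => cases m <;> simp [endPos, crossings, ih, add_assoc]

theorem numAgents_append (m₁ m₂ : List Move) :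
    numAgents (m₁ ++ m₂) = numAgents m₁ + numAgents m₂ := by
  induction m₁ with
  | nil => simp [numAgents]
  | cons m ms ih => cases m <;> simp [numAgents, ih, add_right_comm]

section Moves

variable {T : WTree} {pos : List ℕ} {ms : List Move}

theorem legal_append {m₁ m₂ : List Move} :
    Legal T pos (m₁ ++ m₂) ↔ Legal T pos m₁ ∧ Legal T (endPos T.home pos m₁) m₂ := by
  induction m₁ generalizing pos with
  | nil => simp [Legal, endPos]
  | cons m ms ih => cases m <;> simp [endPos, Legal, ih, and_assoc]

theorem totalDistance_append (T : WTree) (pos : List ℕ) (m₁ m₂ : List Move) :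
    totalDistance T pos (m₁ ++ m₂) =
      totalDistance T pos m₁ + totalDistance T (endPos T.home pos m₁) m₂ := by
  induction m₁ generalizing pos with
  | nil => simp [totalDistance, endPos]
  | cons m ms ih => cases m <;> simp [endPos, totalDistance, ih, add_assoc]

theorem totalDistance_nonneg (h : Legal T pos ms) : 0 ≤ totalDistance T pos ms := by
  induction ms generalizing pos with
  | nil => simp [totalDistance]
  | cons m ms ih =>
    cases m with
    | invoke => exact ih h
    | traverse a v =>
      obtain ⟨⟨u, hu, hadj⟩, h⟩ := h
      simp only [totalDistance, hu]
      exact add_nonneg (T.weight_pos _ hadj).le (ih h)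

theorem mem_visitedVerts {x : ℕ} : x ∈ visitedVerts T ms ↔ ∃ m ∈ ms, reached T m = x := by
  simp [visitedVerts]

theorem visitedVerts_append (T : WTree) (m₁ m₂ : List Move) :
    visitedVerts T (m₁ ++ m₂) = visitedVerts T m₁ ∪ visitedVerts T m₂ := by
  simp [visitedVerts]

theorem visitedVerts_cons (T : WTree) (m : Move) (ms : List Move) :
    visitedVerts T (m :: ms) = insert (reached T m) (visitedVerts T ms) := by
  simp [visitedVerts]

theorem visitedVerts_concat (T : WTree) (ms : List Move) (m : Move) :
    visitedVerts T (ms ++ [m]) = insert (reached T m) (visitedVerts T ms) := by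
  rw [visitedVerts_append, Finset.insert_eq, Finset.union_comm]
  rfl

theorem visited_history {x : ℕ} : Visited (history T ms) x ↔ x ∈ visitedVerts T ms := by
  simp [Visited, history, mem_visitedVerts, observe]

theorem mem_verts_of_mem_visitedVerts (h : Legal T pos ms) {x : ℕ} (hx : x ∈ visitedVerts T ms) :
    x ∈ T.tree.verts := by
  induction ms generalizing pos with
  | nil => simp [visitedVerts] at hx
  | cons m ms ih =>
    rw [visitedVerts_cons, Finset.mem_insert] at hx
    cases m with
    | invoke => exact hx.elim (fun hx => hx ▸ T.home_mem) (ih h)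
    | traverse a v =>
      obtain ⟨⟨u, -, hadj⟩, h⟩ := h
      exact hx.elim (fun hx => hx ▸ T.tree.edge_vert hadj.symm) (ih h)

theorem mem_visitedVerts_of_mem_endPos {x : ℕ} (hx : x ∈ endPos T.home pos ms) :
    x ∈ pos ∨ x ∈ visitedVerts T ms := by
  induction ms generalizing pos with
  | nil => exact Or.inl hx
  | cons m ms ih =>
    rw [visitedVerts_cons, Finset.mem_insert]
    cases m with
    | invoke =>
      have := ih hx
      rw [List.mem_append, List.mem_singleton] at this
      tauto
    | traverse a v =>
      exact (ih hx).elim (fun h => (List.mem_or_eq_of_mem_set h).imp_right Or.inl)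
        (fun h => Or.inr (Or.inr h))

theorem mem_visitedVerts_of_mem_endPos_nil {x : ℕ} (hx : x ∈ endPos T.home [] ms) :
    x ∈ visitedVerts T ms :=
  (mem_visitedVerts_of_mem_endPos hx).resolve_left List.not_mem_nil

theorem reached_mem_endPos_singleton {m : Move} (h : Legal T pos [m]) :
    reached T m ∈ endPos T.home pos [m] := by
  cases m with
  | invoke => simp [endPos, reached]
  | traverse a v =>
    obtain ⟨⟨u, hu, -⟩, -⟩ := h
    exact List.mem_set (List.getElem?_eq_some_iff.1 hu).1 v

theorem exists_append_of_mem_visitedVerts (h : Legal T pos ms) {x : ℕ}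
    (hx : x ∈ visitedVerts T ms) : ∃ m₁ m₂, ms = m₁ ++ m₂ ∧ x ∈ endPos T.home pos m₁ := by
  obtain ⟨m, hm, rfl⟩ := mem_visitedVerts.1 hx
  obtain ⟨m₁, m₂, rfl⟩ := List.append_of_mem hm
  rw [List.append_cons] at h
  refine ⟨m₁ ++ [m], m₂, by simp, ?_⟩
  rw [endPos_append]
  exact reached_mem_endPos_singleton (legal_append.1 (legal_append.1 h).1).2

theorem sum_crossings_le_totalDistance (E : Finset (Sym2 ℕ)) (h : Legal T pos ms) :
    ∑ e ∈ E, T.weight e * crossings T.home e pos ms ≤ totalDistance T pos ms := by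
  induction ms generalizing pos with
  | nil => simp [crossings, totalDistance]
  | cons m ms ih =>
    cases m with
    | invoke => exact ih h
    | traverse a v =>
      obtain ⟨⟨u, hu, hadj⟩, h⟩ := h
      simp only [totalDistance, crossings, hu, Option.map_some, Option.some.injEq, Nat.cast_add,
        Nat.cast_ite, Nat.cast_one, Nat.cast_zero, mul_add, mul_ite, mul_one, mul_zero,
        Finset.sum_add_distrib, Finset.sum_ite_eq]
      refine add_le_add ?_ (ih h)
      split_ifs
      · exact le_rfl
      · exact (T.weight_pos _ hadj).le

end Moves

/-- The number of agents in `D`. -/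
noncomputable def agentsIn (D : Set ℕ) (pos : List ℕ) : ℕ :=
  open Classical in pos.countP (· ∈ D)

section AgentsIn

variable {D D' : Set ℕ} {pos : List ℕ}

theorem agentsIn_pos_iff : 0 < agentsIn D pos ↔ ∃ x ∈ pos, x ∈ D := by
  simp [agentsIn, List.countP_pos_iff]

theorem agentsIn_eq_zero_iff : agentsIn D pos = 0 ↔ ∀ x ∈ pos, x ∉ D := by
  simp [agentsIn, List.countP_eq_zero]

theorem agentsIn_mono (h : D ⊆ D') (pos : List ℕ) : agentsIn D pos ≤ agentsIn D' pos :=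
  List.countP_mono_left fun x _ => by simpa using @h x

theorem agentsIn_union (h : Disjoint D D') (pos : List ℕ) :
    agentsIn (D ∪ D') pos = agentsIn D pos + agentsIn D' pos := by
  classical
  induction pos with
  | nil => rfl
  | cons x pos ih =>
    have : x ∈ D → x ∉ D' := fun hx => Set.disjoint_left.1 h hx
    simp only [agentsIn, List.countP_cons, Set.mem_union, decide_eq_true_eq] at ih ⊢
    rw [ih]
    by_cases hx : x ∈ D <;> by_cases hx' : x ∈ D' <;> simp_all <;> omega

theorem sum_agentsIn_le {ι : Type*} {s : Finset ι} {S : ι → Set ℕ} (hS : ∀ i ∈ s, S i ⊆ D)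
    (hd : Pairwise (Function.onFun Disjoint S)) (pos : List ℕ) :
    ∑ i ∈ s, agentsIn (S i) pos ≤ agentsIn D pos := by
  classical
  refine le_trans (le_of_eq ?_) (agentsIn_mono (Set.iUnion₂_subset hS) pos)
  clear hS
  induction s using Finset.induction_on with
  | empty => simp [agentsIn]
  | insert a s ha ih =>
    rw [Finset.sum_insert ha, Finset.set_biUnion_insert, agentsIn_union, ih]
    exact Set.disjoint_iUnion₂_right.2 fun j hj => hd fun h => ha (h ▸ hj)

theorem agentsIn_set {a u : ℕ} (h : pos[a]? = some u) (v : ℕ) :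
    open Classical in agentsIn D (pos.set a v) + (if u ∈ D then 1 else 0) =
      agentsIn D pos + if v ∈ D then 1 else 0 := by
  classical
  obtain ⟨ha, rfl⟩ := List.getElem?_eq_some_iff.1 h
  have hpos : pos[a] ∈ D → 0 < agentsIn D pos := fun hu =>
    agentsIn_pos_iff.2 ⟨_, List.getElem_mem ha, hu⟩
  simp only [agentsIn, List.countP_set ha, decide_eq_true_eq] at hpos ⊢
  by_cases hu : pos[a] ∈ D
  · have := hpos hu
    split_ifs <;> omega
  · simp only [hu, if_false]
    omega

theorem agentsIn_concat_of_notMem {x : ℕ} (hx : x ∉ D) :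
    agentsIn D (pos ++ [x]) = agentsIn D pos := by
  simp [agentsIn, hx]

end AgentsIn

section Cut

variable {T : WTree} {D : Set ℕ} {e : Sym2 ℕ} {pos : List ℕ} {ms : List Move}

theorem agentsIn_set_le_add_and_le_add (hcut : ∀ u v, T.tree.Adj u v → u ∈ D → v ∉ D → s(u, v) = e)
    {a u v : ℕ} (hu : pos[a]? = some u) (hadj : T.tree.Adj u v) :
    agentsIn D (pos.set a v) ≤ agentsIn D pos + (if s(u, v) = e then 1 else 0) ∧
    agentsIn D pos ≤ agentsIn D (pos.set a v) + (if s(u, v) = e then 1 else 0) := by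
  have h := agentsIn_set (D := D) hu v
  have huv : u ∈ D → v ∉ D → s(u, v) = e := hcut u v hadj
  have hvu : v ∈ D → u ∉ D → s(u, v) = e := fun h h' => Sym2.eq_swap.trans (hcut v u hadj.symm h h')
  split_ifs at h ⊢ <;> first | omega | tauto

theorem agentsIn_endPos_le_add_and_le_add (hhome : T.home ∉ D)
    (hcut : ∀ u v, T.tree.Adj u v → u ∈ D → v ∉ D → s(u, v) = e) (h : Legal T pos ms) :
    agentsIn D (endPos T.home pos ms) ≤ agentsIn D pos + crossings T.home e pos ms ∧
    agentsIn D pos ≤ agentsIn D (endPos T.home pos ms) + crossings T.home e pos ms := by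
  induction ms generalizing pos with
  | nil => simp [endPos, crossings]
  | cons m ms ih =>
    cases m with
    | invoke => simpa only [agentsIn_concat_of_notMem hhome, endPos, crossings] using ih h
    | traverse a v =>
      obtain ⟨⟨u, hu, hadj⟩, h⟩ := h
      have hset := agentsIn_set_le_add_and_le_add hcut hu hadj
      have hend := ih h
      simp only [endPos, crossings, hu, Option.map_some, Option.some.injEq]
      omega

end Cut

/-! ### Runs of a decision rule -/

/-- The rule `next` performs the moves `ms` on `T`, and possibly more. -/
def IsRun (next : List Event → Option Move) (T : WTree) (ms : List Move) : Prop :=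
  ∀ (i : ℕ) (hi : i < ms.length), next (history T (ms.take i)) = some ms[i]

section Runs

variable {next : List Event → Option Move} {T U : WTree} {ms : List Move} {m : Move}

theorem IsRun.nil (next : List Event → Option Move) (T : WTree) : IsRun next T [] :=
  fun _ hi => absurd hi (Nat.not_lt_zero _)

theorem IsRun.concat (h : IsRun next T ms) (hm : next (history T ms) = some m) :
    IsRun next T (ms ++ [m]) := by
  intro i hi
  rcases Nat.lt_or_ge i ms.length with hlt | hge
  · rw [List.take_append_of_le_length hlt.le, List.getElem_append_left hlt]
    exact h i hlt
  · obtain rfl : i = ms.length := by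
      rw [List.length_append, List.length_singleton] at hi
      omega
    simpa using hm

theorem IsRun.of_append {m₁ m₂ : List Move} (h : IsRun next T (m₁ ++ m₂)) : IsRun next T m₁ := by
  intro i hi
  have := h i (by rw [List.length_append]; omega)
  rwa [List.take_append_of_le_length hi.le, List.getElem_append_left hi] at this

theorem IsRun.next_eq {m₁ m₂ : List Move} (h : IsRun next T (m₁ ++ m :: m₂)) :
    next (history T m₁) = some m := by
  simpa using h m₁.length (by simp)

theorem IsRun.congr (h : IsRun next T (ms ++ [m]))
    (hobs : ∀ m' ∈ ms, observe T m' = observe U m') : IsRun next U (ms ++ [m]) := by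
  intro i hi
  have hle : i ≤ ms.length := by
    rw [List.length_append, List.length_singleton] at hi
    omega
  rw [← h i hi, List.take_append_of_le_length hle]
  exact congrArg next (List.map_congr_left fun m' hm' => (hobs m' (List.mem_of_mem_take hm')).symm)

theorem IsRun.prefix_of_performs {L : List Move} (h : IsRun next T L) (hp : Performs next T ms) :
    L <+: ms := by
  induction L using List.reverseRecOn with
  | nil => exact List.nil_prefix
  | append_singleton L m ih =>
    obtain ⟨t, rfl⟩ := ih h.of_append
    have hm : next (history T L) = some m := h.next_eq
    cases t with
    | nil =>
      rw [← List.append_nil L, hp.2] at hm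
      cases hm
    | cons m' t =>
      rw [IsRun.next_eq hp.1, Option.some.injEq] at hm
      exact ⟨t, by simp [hm]⟩

theorem Performs.unique {m₁ m₂ : List Move} (h₁ : Performs next T m₁) (h₂ : Performs next T m₂) :
    m₁ = m₂ :=
  (IsRun.prefix_of_performs h₁.1 h₂).eq_of_length_le
    (IsRun.prefix_of_performs h₂.1 h₁).length_le

theorem OnlineStrategy.performs_moves (S : OnlineStrategy) (T : WTree) :
    Performs S.next T (S.moves T) := (S.explores T).choose_spec.1

theorem OnlineStrategy.explores_moves (S : OnlineStrategy) (T : WTree) :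
    Explores T (S.moves T) := (S.explores T).choose_spec.2

theorem OnlineStrategy.moves_eq {S : OnlineStrategy} (h : Performs S.next T ms) : S.moves T = ms :=
  (S.performs_moves T).unique h

end Runs

/-! ### Descendants and the edges above them -/

/-- The descendants of `v`, including `v`: the vertices from which `v` is reached by iterating
`par`. -/
def descendants (par : ℕ → ℕ) (v : ℕ) : Set ℕ := {x | ∃ k, par^[k] x = v}

section Descendants

variable {par : ℕ → ℕ} {v x : ℕ}

theorem self_mem_descendants (par : ℕ → ℕ) (v : ℕ) : v ∈ descendants par v := ⟨0, rfl⟩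

theorem mem_descendants_of_par (h : par x ∈ descendants par v) : x ∈ descendants par v := by
  obtain ⟨k, hk⟩ := h
  exact ⟨k + 1, hk⟩

theorem par_mem_descendants (h : x ∈ descendants par v) (hne : x ≠ v) :
    par x ∈ descendants par v := by
  obtain ⟨_ | k, hk⟩ := h
  · exact absurd hk hne
  · exact ⟨k, hk⟩

theorem descendants_subset (h : x ∈ descendants par v) : descendants par x ⊆ descendants par v := by
  rintro y ⟨k, rfl⟩
  obtain ⟨k', rfl⟩ := h
  exact ⟨k' + k, Function.iterate_add_apply _ _ _ _⟩

end Descendants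

namespace RootedBy

variable {T : WTree} {par rk : ℕ → ℕ} {v x : ℕ} {pos : List ℕ} {ms : List Move}

theorem home_notMem_descendants (R : RootedBy T par rk) (hv : v ≠ T.home) :
    T.home ∉ descendants par v := by
  rintro ⟨k, hk⟩
  rw [Function.iterate_fixed R.par_home] at hk
  exact hv hk.symm

theorem par_adj (R : RootedBy T par rk) (hv : v ∈ T.tree.verts) (hne : v ≠ T.home) :
    T.tree.Adj (par v) v :=
  (R.adj_iff _ _).2 ⟨R.par_mem v hv, hv, Or.inl ⟨hne, rfl⟩⟩

theorem eq_of_adj_of_mem_descendants (R : RootedBy T par rk) {y : ℕ} (h : T.tree.Adj x y)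
    (hx : x ∈ descendants par v) (hy : y ∉ descendants par v) : s(x, y) = s(v, par v) := by
  obtain ⟨-, -, ⟨-, hpar⟩ | ⟨-, hpar⟩⟩ := (R.adj_iff x y).1 h
  · exact absurd (mem_descendants_of_par (hpar ▸ hx)) hy
  · obtain rfl : x = v := by
      by_contra hne
      exact hy (hpar ▸ par_mem_descendants hx hne)
    rw [hpar]

theorem injOn_parent_edge (R : RootedBy T par rk) :
    Set.InjOn (fun v => s(v, par v)) {v | v ∈ T.tree.verts ∧ v ≠ T.home} := by
  rintro v ⟨hv, hv'⟩ w ⟨hw, hw'⟩ h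
  rcases Sym2.eq_iff.1 h with ⟨h, -⟩ | ⟨h₁, h₂⟩
  · exact h
  · have hlt := R.rk_lt v hv hv'
    have hlt' := R.rk_lt w hw hw'
    rw [h₂] at hlt
    rw [← h₁] at hlt'
    omega

theorem sum_crossings_le_totalDistance (R : RootedBy T par rk) {ι : Type*} {s : Finset ι}
    {f : ι → ℕ} (hinj : Set.InjOn f s) (hf : ∀ i ∈ s, f i ∈ T.tree.verts ∧ f i ≠ T.home)
    (h : Legal T pos ms) :
    ∑ i ∈ s, T.weight s(f i, par (f i)) * crossings T.home s(f i, par (f i)) pos ms ≤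
      totalDistance T pos ms := by
  classical
  have := _root_.sum_crossings_le_totalDistance (s.image fun i => s(f i, par (f i))) h
  rwa [Finset.sum_image] at this
  exact fun i hi j hj hij => hinj hi hj (R.injOn_parent_edge (hf i hi) (hf j hj) hij)

theorem par_mem_visitedVerts (R : RootedBy T par rk) (h : Legal T [] ms)
    (hx : x ∈ visitedVerts T ms) : par x ∈ visitedVerts T ms := by
  induction ms using List.reverseRecOn generalizing x with
  | nil => simp [visitedVerts] at hx
  | append_singleton ms m ih =>
    obtain ⟨hms, hm⟩ := legal_append.1 h
    rw [visitedVerts_concat, Finset.mem_insert] at hx ⊢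
    obtain rfl | hx := hx
    · cases m with
      | invoke => exact Or.inl R.par_home
      | traverse a v =>
        obtain ⟨⟨u, hu, hadj⟩, -⟩ := hm
        have hvis := mem_visitedVerts_of_mem_endPos_nil (List.mem_of_getElem? hu)
        obtain ⟨-, -, ⟨-, rfl⟩ | ⟨-, rfl⟩⟩ := (R.adj_iff u v).1 hadj
        · exact Or.inr hvis
        · exact Or.inr (ih hms (ih hms hvis))
    · exact Or.inr (ih hms hx)

theorem mem_visitedVerts_of_mem_descendants (R : RootedBy T par rk) (h : Legal T [] ms)
    (hx : x ∈ visitedVerts T ms) (hxv : x ∈ descendants par v) : v ∈ visitedVerts T ms := by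
  obtain ⟨k, rfl⟩ := hxv
  induction k with
  | zero => exact hx
  | succ k ih =>
    rw [Function.iterate_succ_apply']
    exact R.par_mem_visitedVerts h ih

theorem agentsIn_endPos_le (R : RootedBy T par rk) (hv : v ≠ T.home) (h : Legal T pos ms) :
    agentsIn (descendants par v) (endPos T.home pos ms) ≤
      agentsIn (descendants par v) pos + crossings T.home s(v, par v) pos ms :=
  (agentsIn_endPos_le_add_and_le_add (R.home_notMem_descendants hv)
    (fun _ _ => R.eq_of_adj_of_mem_descendants) h).1

theorem agentsIn_le_endPos (R : RootedBy T par rk) (hv : v ≠ T.home) (h : Legal T pos ms) :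
    agentsIn (descendants par v) pos ≤
      agentsIn (descendants par v) (endPos T.home pos ms) +
        crossings T.home s(v, par v) pos ms :=
  (agentsIn_endPos_le_add_and_le_add (R.home_notMem_descendants hv)
    (fun _ _ => R.eq_of_adj_of_mem_descendants) h).2

theorem agentsIn_le_crossings (R : RootedBy T par rk) (hv : v ≠ T.home) {m₁ m₂ : List Move}
    (h : Legal T [] (m₁ ++ m₂)) :
    agentsIn (descendants par v) (endPos T.home [] m₁) ≤
      crossings T.home s(v, par v) [] (m₁ ++ m₂) := by
  have := R.agentsIn_endPos_le hv (legal_append.1 h).1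
  rw [crossings_append]
  simp only [agentsIn, List.countP_nil] at this ⊢
  omega

theorem one_le_crossings_of_visited (R : RootedBy T par rk) (hv : v ≠ T.home)
    (h : Legal T pos ms) (hpos : agentsIn (descendants par v) pos = 0)
    (hx : x ∈ visitedVerts T ms) (hxv : x ∈ descendants par v) :
    1 ≤ crossings T.home s(v, par v) pos ms := by
  obtain ⟨m₁, m₂, rfl, hocc⟩ := exists_append_of_mem_visitedVerts h hx
  have hin := R.agentsIn_endPos_le hv (legal_append.1 h).1
  have hpos' := agentsIn_pos_iff.2 ⟨x, hocc, hxv⟩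
  rw [crossings_append]
  omega

theorem two_le_crossings_of_return (R : RootedBy T par rk) (hv : v ≠ T.home)
    (h : Legal T pos ms) (hpos : agentsIn (descendants par v) pos = 0)
    (hx : x ∈ visitedVerts T ms) (hxv : x ∈ descendants par v)
    (hend : agentsIn (descendants par v) (endPos T.home pos ms) = 0) :
    2 ≤ crossings T.home s(v, par v) pos ms := by
  obtain ⟨m₁, m₂, rfl, hocc⟩ := exists_append_of_mem_visitedVerts h hx
  have hin := R.agentsIn_endPos_le hv (legal_append.1 h).1
  have hout := R.agentsIn_le_endPos hv (legal_append.1 h).2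
  have hpos' := agentsIn_pos_iff.2 ⟨x, hocc, hxv⟩
  rw [← endPos_append] at hout
  rw [crossings_append]
  omega

end RootedBy

/-! ### Lower bound on the optimum -/

namespace RootedBy

variable {T : WTree} {par rk : ℕ → ℕ}

/-- The total weight of the edges of `T`, each of which joins a vertex to its parent. -/
noncomputable def totalWeight (_ : RootedBy T par rk) : ℝ :=
  ∑ v ∈ T.finite.toFinset.erase T.home, T.weight s(v, par v)

theorem mem_erase_home {v : ℕ} :
    v ∈ T.finite.toFinset.erase T.home ↔ v ∈ T.tree.verts ∧ v ≠ T.home := by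
  rw [Finset.mem_erase, Set.Finite.mem_toFinset, and_comm]

theorem totalWeight_pos (R : RootedBy T par rk) {v : ℕ} (hv : v ∈ T.tree.verts)
    (hne : v ≠ T.home) : 0 < R.totalWeight := by
  refine Finset.sum_pos (fun w hw => T.weight_pos _ ?_) ⟨v, mem_erase_home.2 ⟨hv, hne⟩⟩
  obtain ⟨hw, hne⟩ := mem_erase_home.1 hw
  exact (R.par_adj hw hne).symm

theorem totalWeight_le_totalDistance (R : RootedBy T par rk) {ms : List Move}
    (h : Explores T ms) : R.totalWeight ≤ totalDistance T [] ms := by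
  refine le_trans (Finset.sum_le_sum fun v hv => ?_)
    (R.sum_crossings_le_totalDistance (f := id) Function.injective_id.injOn
      (fun _ => mem_erase_home.1) h.1)
  obtain ⟨hv, hne⟩ := mem_erase_home.1 hv
  refine le_mul_of_one_le_right (T.weight_pos _ (R.par_adj hv hne).symm).le ?_
  exact_mod_cast R.one_le_crossings_of_visited hne h.1 rfl (mem_visitedVerts.2 (h.2 v hv))
    (self_mem_descendants par v)

end RootedBy

section OptCost

variable {q : ℝ} {T : WTree} {ms : List Move}

theorem numAgents_pos (h : Explores T ms) : 1 ≤ numAgents ms := by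
  obtain ⟨hlegal, hvisit⟩ := h
  match ms with
  | [] =>
    obtain ⟨m, hm, -⟩ := hvisit _ T.home_mem
    exact absurd hm List.not_mem_nil
  | Move.invoke :: ms => exact Nat.le_add_left 1 _
  | Move.traverse a v :: ms =>
    obtain ⟨⟨u, hu, -⟩, -⟩ := hlegal
    simp at hu

theorem cost_nonneg (hq : 0 ≤ q) (h : Legal T [] ms) : 0 ≤ cost q T ms :=
  add_nonneg (mul_nonneg (Nat.cast_nonneg _) hq) (totalDistance_nonneg h)

theorem optCost_le (hq : 0 ≤ q) (h : Explores T ms) : optCost q T ≤ cost q T ms :=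
  csInf_le ⟨0, by rintro c ⟨ms, h, rfl⟩; exact cost_nonneg hq h.1⟩ ⟨ms, h, rfl⟩

theorem RootedBy.le_optCost {par rk : ℕ → ℕ} (R : RootedBy T par rk) (hq : 0 ≤ q)
    (h : Explores T ms) : q + R.totalWeight ≤ optCost q T := by
  refine le_csInf ⟨_, ms, h, rfl⟩ ?_
  rintro c ⟨ms, h, rfl⟩
  refine add_le_add (le_mul_of_one_le_left hq ?_) (R.totalWeight_le_totalDistance h)
  exact_mod_cast numAgents_pos h

end OptCost

/-! ### Depth-first search without return -/

theorem history_concat (T : WTree) (ms : List Move) (m : Move) :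
    history T (ms ++ [m]) = history T ms ++ [observe T m] :=
  List.map_append

theorem eq_of_append_cons_eq_of_not_visited {a a' b b' : List Event} {e e' : Event} {c : ℕ}
    (h : a ++ e :: b = a' ++ e' :: b') (he : e.vertex = c) (he' : e'.vertex = c)
    (ha : ¬ Visited a c) (ha' : ¬ Visited a' c) : a = a' := by
  rcases List.append_eq_append_iff.1 h with ⟨_ | ⟨f, t⟩, rfl, ht⟩ | ⟨_ | ⟨f, t⟩, rfl, ht⟩
  · exact (List.append_nil a).symm
  · obtain ⟨rfl, -⟩ := List.cons_eq_cons.1 ht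
    exact absurd ⟨e, by simp, he⟩ ha'
  · exact List.append_nil a'
  · obtain ⟨rfl, -⟩ := List.cons_eq_cons.1 ht
    exact absurd ⟨e', by simp, he'⟩ ha

theorem IsDFSParent.unique {h : List Event} {c p p' : ℕ} (hp : IsDFSParent h c p)
    (hp' : IsDFSParent h c p') : p = p' := by
  obtain ⟨h₁, h₂, e₁, e₂, rfl, rfl, he, hnew⟩ := hp
  obtain ⟨h₁', h₂', e₁', e₂', heq, rfl, he', hnew'⟩ := hp'
  have := eq_of_append_cons_eq_of_not_visited (a := h₁ ++ [e₁]) (a' := h₁' ++ [e₁'])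
    (by simpa using heq) he he' hnew hnew'
  rw [(List.append_singleton_inj.1 this).2]

theorem IsDFSParent.append {h : List Event} {c p : ℕ} (hp : IsDFSParent h c p) (h' : List Event) :
    IsDFSParent (h ++ h') c p := by
  obtain ⟨h₁, h₂, e₁, e₂, rfl, h⟩ := hp
  exact ⟨h₁, h₂ ++ h', e₁, e₂, by simp, h⟩

theorem exists_dfs_move (h : List Event) (e : Event) : ∃ m : Option Move,
    ((∃ p ∈ e.star, ¬ Visited (h ++ [e]) p.1) →
      ∃ p ∈ e.star, ¬ Visited (h ++ [e]) p.1 ∧ m = some (Move.traverse 0 p.1)) ∧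
    ((∀ p ∈ e.star, Visited (h ++ [e]) p.1) →
      (∃ f ∈ h, ∃ p ∈ f.star, ¬ Visited (h ++ [e]) p.1) →
      ∀ u, IsDFSParent (h ++ [e]) e.vertex u → m = some (Move.traverse 0 u)) ∧
    ((∀ f ∈ h ++ [e], ∀ p ∈ f.star, Visited (h ++ [e]) p.1) → m = none) := by
  have he : e ∈ h ++ [e] := by simp
  by_cases hnew : ∃ p ∈ e.star, ¬ Visited (h ++ [e]) p.1
  · obtain ⟨p, hp, hv⟩ := hnew
    exact ⟨some (Move.traverse 0 p.1), fun _ => ⟨p, hp, hv, rfl⟩,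
      fun hall => absurd (hall p hp) hv, fun hall => absurd (hall e he p hp) hv⟩
  by_cases hdone : ∀ f ∈ h ++ [e], ∀ p ∈ f.star, Visited (h ++ [e]) p.1
  · refine ⟨none, fun hex => absurd hex hnew, ?_, fun _ => rfl⟩
    rintro - ⟨f, hf, p, hp, hv⟩
    exact absurd (hdone f (List.mem_append_left _ hf) p hp) hv
  by_cases hpar : ∃ u, IsDFSParent (h ++ [e]) e.vertex u
  · obtain ⟨u, hu⟩ := hpar
    exact ⟨some (Move.traverse 0 u), fun hex => absurd hex hnew,
      fun _ _ u' hu' => by rw [hu.unique hu'], fun hall => absurd hall hdone⟩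
  · exact ⟨none, fun hex => absurd hex hnew, fun _ _ u hu => absurd ⟨u, hu⟩ hpar, fun _ => rfl⟩

theorem exists_isDFSWithoutReturn : ∃ next, IsDFSWithoutReturn next := by
  choose move hmove using exists_dfs_move
  refine ⟨fun h => if hne : h = [] then some Move.invoke else move h.dropLast (h.getLast hne),
    dif_pos rfl, fun h e => ?_⟩
  simpa using hmove h e

theorem WTree.mem_of_adj_closed {T : WTree} {S : Set ℕ} (hhome : T.home ∈ S)
    (hS : ∀ x ∈ S, ∀ y, T.tree.Adj x y → y ∈ S) {v : ℕ} (hv : v ∈ T.tree.verts) : v ∈ S := by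
  suffices h : ∀ v : T.tree.verts, (v : ℕ) ∈ S from h ⟨v, hv⟩
  intro v
  have hreach := (SimpleGraph.reachable_iff_reflTransGen _ _).1
    (T.isTree.connected ⟨T.home, T.home_mem⟩ v)
  induction hreach with
  | refl => exact hhome
  | @tail x y _ hxy ih => exact hS x ih y hxy

namespace RootedBy

variable {T : WTree} {par rk : ℕ → ℕ} {v : ℕ}

theorem home_mem_visitedVerts (R : RootedBy T par rk) {ms : List Move} (h : Legal T [] ms)
    (hv : v ∈ visitedVerts T ms) : T.home ∈ visitedVerts T ms := by
  refine R.mem_visitedVerts_of_mem_descendants h hv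
    (T.mem_of_adj_closed (self_mem_descendants par _) (fun x hx y hxy => ?_)
      (mem_verts_of_mem_visitedVerts h hv))
  obtain ⟨-, -, ⟨-, rfl⟩ | ⟨hne, rfl⟩⟩ := (R.adj_iff x y).1 hxy
  · exact mem_descendants_of_par hx
  · exact par_mem_descendants hx hne

theorem par_notMem_descendants (R : RootedBy T par rk) (hv : v ∈ T.tree.verts)
    (hne : v ≠ T.home) : par v ∉ descendants par v := by
  have rk_le : ∀ k, ∀ x ∈ T.tree.verts, rk (par^[k] x) ≤ rk x := by
    intro k
    induction k with
    | zero => exact fun _ _ => le_rfl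
    | succ k ih =>
      intro x hx
      refine (ih (par x) (R.par_mem x hx)).trans ?_
      obtain rfl | hxne := eq_or_ne x T.home
      · rw [R.par_home]
      · exact (R.rk_lt x hx hxne).le
  rintro ⟨k, hk⟩
  have := rk_le k (par v) (R.par_mem v hv)
  rw [hk] at this
  exact (R.rk_lt v hv hne).not_ge this

theorem sum_weight_le_totalWeight (R : RootedBy T par rk) {F : Finset ℕ}
    (hF : ∀ v ∈ F, v ∈ T.tree.verts ∧ v ≠ T.home) :
    ∑ v ∈ F, T.weight s(v, par v) ≤ R.totalWeight := by
  refine Finset.sum_le_sum_of_subset_of_nonneg (fun v hv => ?_) fun v hv _ => ?_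
  · exact Finset.mem_erase.2 ⟨(hF v hv).2, T.finite.mem_toFinset.2 (hF v hv).1⟩
  · rw [Finset.mem_erase, Set.Finite.mem_toFinset] at hv
    exact (T.weight_pos _ (R.par_adj hv.2 hv.1).symm).le

end RootedBy

/-- The rule `next` performs on `T` the moves `ms`, in which a single agent is invoked and walks to
`c`. -/
structure IsWalkTo (next : List Event → Option Move) (T : WTree) (ms : List Move) (c : ℕ) :
    Prop where
  run : IsRun next T ms
  legal : Legal T [] ms
  endPos_eq : endPos T.home [] ms = [c]
  numAgents_eq : numAgents ms = 1
  eq_concat : ∃ ms' m, ms = ms' ++ [m] ∧ reached T m = c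

namespace IsWalkTo

variable {next : List Event → Option Move} {T : WTree} {ms : List Move} {c v : ℕ}

theorem concat (h : IsWalkTo next T ms c) (hadj : T.tree.Adj c v)
    (hnext : next (history T ms) = some (Move.traverse 0 v)) :
    IsWalkTo next T (ms ++ [Move.traverse 0 v]) v where
  run := h.run.concat hnext
  legal := legal_append.2 ⟨h.legal, h.endPos_eq ▸ ⟨⟨c, rfl, hadj⟩, trivial⟩⟩
  endPos_eq := by
    rw [endPos_append, h.endPos_eq]
    rfl
  numAgents_eq := by
    rw [numAgents_append, h.numAgents_eq]
    rfl
  eq_concat := ⟨ms, _, rfl, rfl⟩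

theorem mem_visitedVerts (h : IsWalkTo next T ms c) : c ∈ visitedVerts T ms :=
  mem_visitedVerts_of_mem_endPos_nil (h.endPos_eq ▸ List.mem_singleton_self c)

theorem mem_verts (h : IsWalkTo next T ms c) : c ∈ T.tree.verts :=
  mem_verts_of_mem_visitedVerts h.legal h.mem_visitedVerts

theorem totalDistance_concat (h : IsWalkTo next T ms c) (v : ℕ) :
    totalDistance T [] (ms ++ [Move.traverse 0 v]) = totalDistance T [] ms + T.weight s(c, v) := by
  simp [totalDistance_append, h.endPos_eq, totalDistance]

theorem isDFSParent_concat (h : IsWalkTo next T ms c) (hv : v ∉ visitedVerts T ms) :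
    IsDFSParent (history T (ms ++ [Move.traverse 0 v])) v c := by
  obtain ⟨ms', m, rfl, hm⟩ := h.eq_concat
  refine ⟨history T ms', [], observe T m, observe T (Move.traverse 0 v), ?_, hm, rfl, ?_⟩
  · simp [history]
  · rwa [← history_concat, visited_history]

end IsWalkTo

/-- A state of depth-first search after the moves `ms`: the agent is at `c`, and `F` is the set of
the finished vertices, those from which the agent has gone back to the parent. -/
structure DFSState (next : List Event → Option Move) (T : WTree) (par : ℕ → ℕ)
    (ms : List Move) (c : ℕ) (F : Finset ℕ) : Prop extends IsWalkTo next T ms c where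
  isDFSParent : ∀ x ∈ visitedVerts T ms, x ≠ T.home → IsDFSParent (history T ms) x (par x)
  visited_of_finished : ∀ x ∈ F, x ∈ visitedVerts T ms ∧ x ≠ T.home
  current_notMem : c ∉ F
  finished_of_par : ∀ x ∈ T.tree.verts, x ≠ T.home → par x ∈ F → x ∈ F
  mem_descendants : ∀ x ∈ visitedVerts T ms, x ∉ F → c ∈ descendants par x
  totalDistance_eq : totalDistance T [] ms =
    ∑ v ∈ (visitedVerts T ms).erase T.home, T.weight s(v, par v) + ∑ v ∈ F, T.weight s(v, par v)

namespace DFSState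

variable {next : List Event → Option Move} {T : WTree} {par rk : ℕ → ℕ} {ms : List Move} {c : ℕ}
  {F : Finset ℕ}

theorem start (hn : IsDFSWithoutReturn next) (T : WTree) (par : ℕ → ℕ) :
    DFSState next T par [Move.invoke] T.home ∅ where
  run := IsRun.concat (IsRun.nil _ _) hn.1
  legal := trivial
  endPos_eq := rfl
  numAgents_eq := rfl
  eq_concat := ⟨[], Move.invoke, rfl, rfl⟩
  isDFSParent := fun x hx hne => absurd (Finset.mem_singleton.1 hx) hne
  visited_of_finished := fun _ hx => absurd hx (Finset.notMem_empty _)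
  current_notMem := Finset.notMem_empty _
  finished_of_par := fun _ _ _ hx => absurd hx (Finset.notMem_empty _)
  mem_descendants := fun x hx _ => Finset.mem_singleton.1 hx ▸ self_mem_descendants par _
  totalDistance_eq := by simp [totalDistance, visitedVerts, reached]

theorem down (h : DFSState next T par ms c F) (R : RootedBy T par rk) {v : ℕ}
    (hadj : T.tree.Adj c v) (hv : v ∉ visitedVerts T ms)
    (hnext : next (history T ms) = some (Move.traverse 0 v)) :
    DFSState next T par (ms ++ [Move.traverse 0 v]) v F := by
  obtain ⟨hne, hpar⟩ : v ≠ T.home ∧ par v = c :=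
    ((R.adj_iff c v).1 hadj).2.2.resolve_right fun hup =>
      hv (hup.2 ▸ R.par_mem_visitedVerts h.legal h.mem_visitedVerts)
  refine ⟨h.concat hadj hnext, ?_, ?_, fun hF => hv (h.visited_of_finished v hF).1,
    h.finished_of_par, ?_, ?_⟩
  all_goals rw [visitedVerts_concat, reached]
  · intro x hx hxne
    obtain rfl | hx := Finset.mem_insert.1 hx
    · exact hpar.symm ▸ h.isDFSParent_concat hv
    · rw [history_concat]
      exact (h.isDFSParent x hx hxne).append _
  · exact fun x hx => (h.visited_of_finished x hx).imp_left Finset.mem_insert_of_mem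
  · intro x hx hxF
    obtain rfl | hx := Finset.mem_insert.1 hx
    · exact self_mem_descendants par x
    · exact mem_descendants_of_par (hpar ▸ h.mem_descendants x hx hxF)
  · rw [h.totalDistance_concat, h.totalDistance_eq, Finset.erase_insert_of_ne hne,
      Finset.sum_insert (fun hmem => hv (Finset.mem_of_mem_erase hmem)), hpar, Sym2.eq_swap]
    ring

theorem up (h : DFSState next T par ms c F) (R : RootedBy T par rk) (hne : c ≠ T.home)
    (hstar : ∀ v, T.tree.Adj c v → v ∈ visitedVerts T ms)
    (hnext : next (history T ms) = some (Move.traverse 0 (par c))) :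
    DFSState next T par (ms ++ [Move.traverse 0 (par c)]) (par c) (insert c F) ∧
      visitedVerts T (ms ++ [Move.traverse 0 (par c)]) = visitedVerts T ms := by
  have hvisit : visitedVerts T (ms ++ [Move.traverse 0 (par c)]) = visitedVerts T ms := by
    rw [visitedVerts_concat, reached]
    exact Finset.insert_eq_of_mem (R.par_mem_visitedVerts h.legal h.mem_visitedVerts)
  refine ⟨⟨h.concat (R.par_adj h.mem_verts hne).symm hnext, ?_, ?_, ?_, ?_, ?_, ?_⟩, hvisit⟩
  all_goals simp only [hvisit, Finset.mem_insert]
  · intro x hx hxne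
    rw [history_concat]
    exact (h.isDFSParent x hx hxne).append _
  · rintro x (rfl | hx)
    · exact ⟨h.mem_visitedVerts, hne⟩
    · exact h.visited_of_finished x hx
  · rintro (heq | hF)
    · exact R.par_notMem_descendants h.mem_verts hne ⟨0, heq⟩
    · exact h.current_notMem (h.finished_of_par c h.mem_verts hne hF)
  · rintro x hx hxne (hpar | hF)
    · refine Or.inr (by_contra fun hxF => R.par_notMem_descendants hx hxne ?_)
      exact hpar.symm ▸ h.mem_descendants x (hstar x (hpar ▸ R.par_adj hx hxne)) hxF
    · exact Or.inr (h.finished_of_par x hx hxne hF)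
  · intro x hx hxF
    rw [not_or] at hxF
    exact par_mem_descendants (h.mem_descendants x hx hxF.2) (Ne.symm hxF.1)
  · rw [h.totalDistance_concat, h.totalDistance_eq, Finset.sum_insert h.current_notMem]
    ring

theorem cost_le (h : DFSState next T par ms c F) (R : RootedBy T par rk) (q : ℝ) :
    cost q T ms ≤ q + 2 * R.totalWeight := by
  have hvisit : ∀ x ∈ visitedVerts T ms, x ∈ T.tree.verts :=
    fun x => mem_verts_of_mem_visitedVerts h.legal
  have hdown := R.sum_weight_le_totalWeight (F := (visitedVerts T ms).erase T.home) fun x hx =>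
    ⟨hvisit x (Finset.mem_of_mem_erase hx), Finset.ne_of_mem_erase hx⟩
  have hup := R.sum_weight_le_totalWeight (F := F) fun x hx =>
    (h.visited_of_finished x hx).imp_left (hvisit x)
  rw [cost, h.numAgents_eq, h.totalDistance_eq, Nat.cast_one]
  linarith

theorem card_le (h : DFSState next T par ms c F) :
    (visitedVerts T ms).card + F.card ≤ 2 * T.finite.toFinset.card := by
  have hvisit := Finset.card_le_card (s := visitedVerts T ms) (t := T.finite.toFinset)
    fun x hx => T.finite.mem_toFinset.2 (mem_verts_of_mem_visitedVerts h.legal hx)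
  have hF := Finset.card_le_card fun x hx => (h.visited_of_finished x hx).1
  omega

theorem explores (h : DFSState next T par ms c F) (R : RootedBy T par rk)
    (hstar : ∀ x ∈ visitedVerts T ms, ∀ y, T.tree.Adj x y → y ∈ visitedVerts T ms) :
    Explores T ms :=
  ⟨h.legal, fun _ hx => mem_visitedVerts.1 (T.mem_of_adj_closed (S := visitedVerts T ms)
    (R.home_mem_visitedVerts h.legal h.mem_visitedVerts) hstar hx)⟩

theorem current_ne_home (h : DFSState next T par ms c F) (R : RootedBy T par rk)
    (hstar : ∀ v, T.tree.Adj c v → v ∈ visitedVerts T ms) {x y : ℕ}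
    (hx : x ∈ visitedVerts T ms) (hxy : T.tree.Adj x y) (hy : y ∉ visitedVerts T ms) :
    c ≠ T.home := by
  rintro rfl
  obtain ⟨-, hyT, ⟨hyne, rfl⟩ | ⟨-, rfl⟩⟩ := (R.adj_iff x y).1 hxy
  · by_cases hF : par y ∈ F
    · exact hy (h.visited_of_finished y (h.finished_of_par y hyT hyne hF)).1
    · by_cases hroot : par y = T.home
      · exact hy (hstar y (hroot ▸ hxy))
      · exact R.home_notMem_descendants hroot (h.mem_descendants _ hx hF)
  · exact hy (R.par_mem_visitedVerts h.legal hx)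

theorem exists_succ_or_explores (h : DFSState next T par ms c F) (hn : IsDFSWithoutReturn next)
    (R : RootedBy T par rk) :
    (∃ ms' c' F', DFSState next T par ms' c' F' ∧
      (visitedVerts T ms').card + F'.card = (visitedVerts T ms).card + F.card + 1) ∨
    (Performs next T ms ∧ Explores T ms) := by
  obtain ⟨ms', m, hms, rfl⟩ := h.eq_concat
  have hhist : history T ms' ++ [observe T m] = history T ms := by rw [hms, history_concat]
  have hrule := hn.2 (history T ms') (observe T m)
  simp only [hhist, visited_history] at hrule
  obtain ⟨hdown, hup, hquit⟩ := hrule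
  by_cases hnew : ∃ p ∈ (observe T m).star, p.1 ∉ visitedVerts T ms
  · obtain ⟨p, hp, hv, hnext⟩ := hdown hnew
    refine Or.inl ⟨_, _, _, h.down R hp.1 hv hnext, ?_⟩
    rw [visitedVerts_concat, reached, Finset.card_insert_of_notMem hv, add_right_comm]
  push Not at hnew
  have hstar : ∀ v, T.tree.Adj (reached T m) v → v ∈ visitedVerts T ms :=
    fun v hv => hnew (v, T.weight s(reached T m, v)) ⟨hv, rfl⟩
  by_cases hdone : ∀ x ∈ visitedVerts T ms, ∀ y, T.tree.Adj x y → y ∈ visitedVerts T ms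
  · refine Or.inr ⟨⟨h.run, hquit fun f hf p hp => ?_⟩, h.explores R hdone⟩
    obtain ⟨m', hm', rfl⟩ := List.mem_map.1 hf
    exact hdone _ (mem_visitedVerts.2 ⟨m', hm', rfl⟩) p.1 hp.1
  push Not at hdone
  obtain ⟨x, hx, y, hxy, hy⟩ := hdone
  have hne := h.current_ne_home R hstar hx hxy hy
  obtain ⟨m', hm', rfl⟩ := mem_visitedVerts.1 hx
  have hm'' : m' ∈ ms' := by
    rw [hms, List.mem_append, List.mem_singleton] at hm'
    exact hm'.resolve_right fun heq => hy (hstar y (heq ▸ hxy))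
  have hnext := hup hnew
    ⟨_, List.mem_map_of_mem hm'', (y, T.weight s(reached T m', y)), ⟨hxy, rfl⟩, hy⟩ _
    (h.isDFSParent _ h.mem_visitedVerts hne)
  obtain ⟨hstate, hvisit⟩ := h.up R hne hstar hnext
  refine Or.inl ⟨_, _, _, hstate, ?_⟩
  rw [hvisit, Finset.card_insert_of_notMem h.current_notMem, add_assoc]

theorem exists_performs_explores (h : DFSState next T par ms c F) (hn : IsDFSWithoutReturn next)
    (R : RootedBy T par rk) :
    ∃ ms c F, DFSState next T par ms c F ∧ Performs next T ms ∧ Explores T ms := by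
  induction hk : 2 * T.finite.toFinset.card - ((visitedVerts T ms).card + F.card)
    using Nat.strong_induction_on generalizing ms c F with
  | _ k ih =>
    obtain ⟨ms', c', F', h', hcard⟩ | hexp := h.exists_succ_or_explores hn R
    · have := h'.card_le
      exact ih _ (by omega) h' rfl
    · exact ⟨ms, c, F, h, hexp⟩

end DFSState

theorem IsDFSWithoutReturn.exists_performs {next : List Event → Option Move}
    (hn : IsDFSWithoutReturn next) {T : WTree} {par rk : ℕ → ℕ} (R : RootedBy T par rk) (q : ℝ) :
    ∃ ms, Performs next T ms ∧ Explores T ms ∧ cost q T ms ≤ q + 2 * R.totalWeight := by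
  obtain ⟨ms, c, F, h, hperf, hexp⟩ := (DFSState.start hn T par).exists_performs_explores hn R
  exact ⟨ms, hperf, hexp, h.cost_le R q⟩

theorem exists_explores (T : WTree) : ∃ ms, Explores T ms := by
  obtain ⟨next, hn⟩ := exists_isDFSWithoutReturn
  obtain ⟨par, rk, R⟩ := T.exists_rootedBy
  obtain ⟨ms, -, h, -⟩ := hn.exists_performs R 0
  exact ⟨ms, h⟩

theorem IsDFSWithoutReturn.exists_onlineStrategy {q : ℝ} (hq : 0 ≤ q)
    {next : List Event → Option Move} (hn : IsDFSWithoutReturn next) :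
    ∃ S : OnlineStrategy, S.next = next ∧ competitiveRatio q S ≤ 2 := by
  have hex : ∀ T : WTree, ∃ ms, Performs next T ms ∧ Explores T ms := by
    intro T
    obtain ⟨par, rk, R⟩ := T.exists_rootedBy
    obtain ⟨ms, hperf, hexp, -⟩ := hn.exists_performs R 0
    exact ⟨ms, hperf, hexp⟩
  refine ⟨⟨next, hex⟩, rfl, iSup_le fun T => ENNReal.div_le_of_le_mul ?_⟩
  obtain ⟨par, rk, R⟩ := T.exists_rootedBy
  obtain ⟨ms, hperf, hexp, hcost⟩ := hn.exists_performs R q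
  have hopt := R.le_optCost hq hexp
  rw [OnlineStrategy.costOn, OnlineStrategy.moves_eq (S := ⟨next, hex⟩) hperf,
    ← ENNReal.ofReal_ofNat 2, ← ENNReal.ofReal_mul zero_le_two]
  exact ENNReal.ofReal_le_ofReal (by linarith)

/-! ### The trees used by the adversary -/

/-- Names of the vertices of the adversary's trees: the homebase, and the vertices of the branches,
each given by its stage, its branch and its depth in the branch. -/
noncomputable def vertexName : Option (ℕ × Bool × ℕ) ≃ ℕ := nonempty_equiv_of_countable.some

/-- The homebase of the adversary's trees. -/
noncomputable def rootName : ℕ := vertexName none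

/-- The vertex of branch `b` of stage `i` at distance `d + 1` from the branching vertex. -/
noncomputable def nodeName (i : ℕ) (b : Bool) (d : ℕ) : ℕ := vertexName (some (i, b, d))

theorem nodeName_inj {i j d e : ℕ} {b c : Bool} :
    nodeName i b d = nodeName j c e ↔ i = j ∧ b = c ∧ d = e := by
  simp [nodeName]

theorem nodeName_ne_rootName (i : ℕ) (b : Bool) (d : ℕ) : nodeName i b d ≠ rootName := by
  simp [nodeName, rootName]

theorem eq_rootName_or_nodeName (x : ℕ) : x = rootName ∨ ∃ i b d, x = nodeName i b d := by
  obtain ⟨_ | ⟨i, b, d⟩, rfl⟩ := vertexName.surjective x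
  · exact Or.inl rfl
  · exact Or.inr ⟨i, b, d, rfl⟩

/-- The choices of the adversary, for each stage `i`: the branch that continues the spine, and the
length of the other branch, the side branch. Stage `0` is the first segment of the spine and has no
side branch; the paper's tree ends with stage `l`. -/
structure BranchData (l : ℕ) where
  side : ℕ → Bool
  len : ℕ → ℕ
  len_le : ∀ i, len i ≤ l
  len_zero : len 0 = 0
  len_pos : ∀ i, 1 ≤ i → 1 ≤ len i

namespace BranchData

variable {l : ℕ}

section Basic

variable (p : BranchData l)

/-- The number of vertices of branch `b` of stage `i`. -/
def branchLen (i : ℕ) (b : Bool) : ℕ := if b = p.side i then l else p.len i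

/-- The vertex to which the branches of stage `i` are attached. -/
noncomputable def base : ℕ → ℕ
  | 0 => rootName
  | i + 1 => nodeName i (p.side i) (l - 1)

/-- The vertex at distance `d` from the branching vertex on branch `b` of stage `i`. -/
noncomputable def branchPoint (i : ℕ) (b : Bool) : ℕ → ℕ
  | 0 => p.base i
  | d + 1 => nodeName i b d

/-- The parent function of the tree of the data `p`. -/
noncomputable def par (x : ℕ) : ℕ :=
  match vertexName.symm x with
  | none => rootName
  | some (i, b, d) => p.branchPoint i b d

/-- The distance from the homebase. -/
noncomputable def rk (_ : BranchData l) (x : ℕ) : ℕ :=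
  match vertexName.symm x with
  | none => 0
  | some (i, _, d) => i * l + d + 1

/-- The vertices of the stages `0, …, l`. -/
def verts : Set ℕ :=
  insert rootName {x | ∃ i b d, i ≤ l ∧ d < p.branchLen i b ∧ nodeName i b d = x}

theorem one_le (p : BranchData l) : 1 ≤ l := (p.len_pos 1 le_rfl).trans (p.len_le 1)

theorem branchLen_side (i : ℕ) : p.branchLen i (p.side i) = l := if_pos rfl

theorem branchLen_not_side (i : ℕ) : p.branchLen i (!p.side i) = p.len i :=
  if_neg (Bool.not_ne_self _)

theorem branchLen_le (i : ℕ) (b : Bool) : p.branchLen i b ≤ l := by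
  unfold branchLen
  split_ifs
  exacts [le_rfl, p.len_le i]

theorem one_le_branchLen {i : ℕ} (hi : 1 ≤ i) (b : Bool) : 1 ≤ p.branchLen i b := by
  unfold branchLen
  split_ifs
  exacts [p.one_le, p.len_pos i hi]

theorem base_succ (i : ℕ) : p.base (i + 1) = p.branchPoint i (p.side i) l := by
  obtain ⟨k, rfl⟩ := Nat.exists_eq_add_of_le' p.one_le
  rfl

theorem par_rootName : p.par rootName = rootName := by simp [par, rootName]

theorem par_nodeName (i : ℕ) (b : Bool) (d : ℕ) : p.par (nodeName i b d) = p.branchPoint i b d := by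
  simp [par, nodeName]

theorem rk_rootName : p.rk rootName = 0 := by simp [rk, rootName]

theorem rk_nodeName (i : ℕ) (b : Bool) (d : ℕ) : p.rk (nodeName i b d) = i * l + d + 1 := by
  simp [rk, nodeName]

theorem rk_branchPoint (i : ℕ) (b : Bool) (d : ℕ) : p.rk (p.branchPoint i b d) = i * l + d := by
  rcases d with _ | d
  · rcases i with _ | i
    · rw [branchPoint, base, rk_rootName, Nat.zero_mul]
    · have := p.one_le
      rw [branchPoint, base, rk_nodeName, Nat.succ_mul]
      omega
  · exact p.rk_nodeName i b d

theorem rootName_mem_verts : rootName ∈ p.verts := Set.mem_insert _ _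

theorem nodeName_mem_verts {i : ℕ} {b : Bool} {d : ℕ} :
    nodeName i b d ∈ p.verts ↔ i ≤ l ∧ d < p.branchLen i b := by
  simp only [verts, Set.mem_insert_iff, nodeName_ne_rootName, false_or, Set.mem_ofPred_eq]
  exact ⟨fun ⟨_, _, _, hi, hd, h⟩ => by obtain ⟨rfl, rfl, rfl⟩ := nodeName_inj.1 h; exact ⟨hi, hd⟩,
    fun ⟨hi, hd⟩ => ⟨i, b, d, hi, hd, rfl⟩⟩

theorem base_mem_verts {i : ℕ} (hi : i ≤ l) : p.base i ∈ p.verts := by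
  rcases i with _ | i
  · exact p.rootName_mem_verts
  · refine p.nodeName_mem_verts.2 ⟨Nat.le_of_succ_le hi, ?_⟩
    rw [branchLen_side]
    exact Nat.sub_lt p.one_le one_pos

theorem branchPoint_mem_verts {i : ℕ} {b : Bool} {d : ℕ} (hi : i ≤ l) (hd : d ≤ p.branchLen i b) :
    p.branchPoint i b d ∈ p.verts := by
  rcases d with _ | d
  · exact p.base_mem_verts hi
  · exact p.nodeName_mem_verts.2 ⟨hi, hd⟩

theorem verts_finite : p.verts.Finite := by
  have hbox := (Set.finite_Iic l).prod ((Set.finite_univ (α := Bool)).prod (Set.finite_Iio l))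
  refine ((hbox.image fun t => nodeName t.1 t.2.1 t.2.2).subset ?_).insert _
  rintro x ⟨i, b, d, hi, hd, rfl⟩
  exact ⟨(i, b, d), ⟨hi, trivial, hd.trans_le (p.branchLen_le i b)⟩, rfl⟩

theorem par_mem_verts {x : ℕ} (hx : x ∈ p.verts) : p.par x ∈ p.verts := by
  obtain rfl | ⟨i, b, d, hi, hd, rfl⟩ := hx
  · rw [par_rootName]
    exact p.rootName_mem_verts
  · exact p.par_nodeName i b d ▸ p.branchPoint_mem_verts hi hd.le

theorem rk_par_lt {x : ℕ} (hx : x ≠ rootName) : p.rk (p.par x) < p.rk x := by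
  obtain ⟨i, b, d, rfl⟩ := (eq_rootName_or_nodeName x).resolve_left hx
  rw [par_nodeName, rk_branchPoint, rk_nodeName]
  exact Nat.lt_succ_self _

/-- The unit-weight tree with the stages `0, …, l` of the data `p`. -/
noncomputable def tree : WTree :=
  WTree.ofParent p.verts rootName p.par p.rk p.verts_finite p.rootName_mem_verts
    (fun _ => p.par_mem_verts) (fun _ _ => p.rk_par_lt) p.par_rootName

theorem rootedBy : RootedBy p.tree p.par p.rk := WTree.ofParent_rootedBy _ _ _ _ _

theorem reached_tree (p p' : BranchData l) (m : Move) : reached p.tree m = reached p'.tree m := by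
  cases m <;> rfl

theorem visitedVerts_tree (p p' : BranchData l) (ms : List Move) :
    visitedVerts p.tree ms = visitedVerts p'.tree ms := by
  rw [visitedVerts, visitedVerts, funext (reached_tree p p')]

end Basic

/-! ### Descendants in the adversary's trees -/

section Descendants

variable (p : BranchData l) {i j d e : ℕ} {b c : Bool}

theorem branchPoint_mem_descendants (hde : d < e) :
    p.branchPoint i b e ∈ descendants p.par (nodeName i b d) := by
  induction e, hde using Nat.le_induction with
  | base => exact self_mem_descendants _ _
  | succ e _ ih =>
    refine mem_descendants_of_par ?_
    rwa [branchPoint, par_nodeName]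

theorem nodeName_mem_descendants (hde : d ≤ e) :
    nodeName i b e ∈ descendants p.par (nodeName i b d) :=
  p.branchPoint_mem_descendants (Nat.lt_succ_of_le hde)

theorem branchPoint_mem_descendants_base (i : ℕ) (b : Bool) (d : ℕ) :
    p.branchPoint i b d ∈ descendants p.par (p.base i) := by
  induction d with
  | zero => exact self_mem_descendants _ _
  | succ d ih =>
    refine mem_descendants_of_par ?_
    rwa [branchPoint, par_nodeName]

theorem nodeName_mem_descendants_of_lt (hij : i < j) (hd : d < l) (c : Bool) (e : ℕ) :
    nodeName j c e ∈ descendants p.par (nodeName i (p.side i) d) := by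
  refine descendants_subset ?_ (p.branchPoint_mem_descendants_base j c (e + 1))
  induction j, hij using Nat.le_induction with
  | base => exact p.base_succ i ▸ p.branchPoint_mem_descendants hd
  | succ j _ ih =>
    exact descendants_subset ih (p.base_succ j ▸ p.branchPoint_mem_descendants_base j _ l)

theorem exists_eq_nodeName_of_mem_descendants {x : ℕ}
    (h : x ∈ descendants p.par (nodeName i b d)) :
    (∃ e, x = nodeName i b e) ∨ (b = p.side i ∧ ∃ j c e, i < j ∧ x = nodeName j c e) := by
  obtain ⟨k, hk⟩ := h
  induction k generalizing x with
  | zero => exact Or.inl ⟨d, hk⟩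
  | succ k ih =>
    replace ih := ih (x := p.par x) hk
    obtain rfl | ⟨j, c, e, rfl⟩ := eq_rootName_or_nodeName x
    · simp [par_rootName, (nodeName_ne_rootName _ _ _).symm] at ih
    rw [par_nodeName] at ih
    rcases e with _ | e
    · rcases j with _ | j
      · simp [branchPoint, base, (nodeName_ne_rootName _ _ _).symm] at ih
      · simp only [branchPoint, base, nodeName_inj] at ih
        obtain ⟨_, rfl, rfl, -⟩ | ⟨hb, _, _, _, hij, rfl, -⟩ := ih
        · exact Or.inr ⟨rfl, _, _, _, Nat.lt_succ_self _, rfl⟩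
        · exact Or.inr ⟨hb, _, _, _, Nat.lt_succ_of_lt hij, rfl⟩
    · simp only [branchPoint, nodeName_inj] at ih
      obtain ⟨_, rfl, rfl, -⟩ | ⟨hb, _, _, _, hij, rfl, -⟩ := ih
      · exact Or.inl ⟨_, rfl⟩
      · exact Or.inr ⟨hb, _, _, _, hij, rfl⟩

theorem exists_eq_nodeName_of_mem_descendants_not_side {x : ℕ}
    (h : x ∈ descendants p.par (nodeName i (!p.side i) d)) : ∃ e, x = nodeName i (!p.side i) e :=
  (p.exists_eq_nodeName_of_mem_descendants h).resolve_right fun h => Bool.not_ne_self _ h.1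

theorem nodeName_not_side_notMem_descendants :
    nodeName i (!p.side i) e ∉ descendants p.par (nodeName i (p.side i) d) := by
  intro h
  simpa [nodeName_inj] using p.exists_eq_nodeName_of_mem_descendants h

end Descendants

end BranchData

/-! ### Adversary trees that agree on the first stages -/

namespace BranchData

variable {l : ℕ} {p p' : BranchData l} {i j d : ℕ} {b : Bool}

/-- The data obtained from `p` by changing the stage `i`. -/
def setStage (p : BranchData l) (i : ℕ) (σ : Bool) (k : ℕ) (hi : 1 ≤ i) (hk : 1 ≤ k)
    (hkl : k ≤ l) : BranchData l where
  side := Function.update p.side i σ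
  len := Function.update p.len i k
  len_le := Function.forall_update_iff p.len (fun _ m => m ≤ l) |>.2 ⟨hkl, fun j _ => p.len_le j⟩
  len_zero := by rw [Function.update_of_ne (by omega), p.len_zero]
  len_pos := Function.forall_update_iff p.len (fun j m => 1 ≤ j → 1 ≤ m) |>.2
    ⟨fun _ => hk, fun j _ => p.len_pos j⟩

/-- The data `p` and `p'` agree before stage `i`. -/
def AgreeBefore (p p' : BranchData l) (i : ℕ) : Prop :=
  ∀ j < i, p.side j = p'.side j ∧ p.len j = p'.len j

/-- The vertices all of whose neighbours belong to the stages `0, …, i`. -/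
def interior (p : BranchData l) (i : ℕ) : Set ℕ :=
  insert rootName {x | ∃ j b d, nodeName j b d = x ∧
    (j < i ∧ d < p.branchLen j b ∨ j = i ∧ d + 1 < p.branchLen j b)}

theorem nodeName_mem_interior : nodeName j b d ∈ p.interior i ↔
    j < i ∧ d < p.branchLen j b ∨ j = i ∧ d + 1 < p.branchLen j b := by
  simp only [interior, Set.mem_insert_iff, nodeName_ne_rootName, false_or, Set.mem_ofPred_eq]
  exact ⟨fun ⟨_, _, _, hx, h⟩ => by obtain ⟨rfl, rfl, rfl⟩ := nodeName_inj.1 hx; exact h,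
    fun h => ⟨j, b, d, rfl, h⟩⟩

theorem interior_subset_verts (hi : i ≤ l) : p.interior i ⊆ p.verts := by
  rintro x (rfl | ⟨j, b, d, rfl, h⟩)
  · exact p.rootName_mem_verts
  · exact p.nodeName_mem_verts.2 (by omega)

theorem AgreeBefore.symm (h : p.AgreeBefore p' i) : p'.AgreeBefore p i :=
  fun j hj => ⟨(h j hj).1.symm, (h j hj).2.symm⟩

theorem AgreeBefore.mono (h : p.AgreeBefore p' i) (hji : j ≤ i) : p.AgreeBefore p' j :=
  fun k hk => h k (hk.trans_le hji)

theorem AgreeBefore.setStage (h : p.AgreeBefore p' i) {σ : Bool} {k : ℕ} (hi : 1 ≤ i) (hk : 1 ≤ k)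
    (hkl : k ≤ l) : (p.setStage i σ k hi hk hkl).AgreeBefore p' i := by
  intro j hj
  simpa [BranchData.setStage, hj.ne] using h j hj

theorem AgreeBefore.branchLen_eq (h : p.AgreeBefore p' i) (hj : j < i) (b : Bool) :
    p.branchLen j b = p'.branchLen j b := by
  simp [branchLen, h j hj]

theorem AgreeBefore.base_eq (h : p.AgreeBefore p' i) (hj : j ≤ i) : p.base j = p'.base j := by
  rcases j with _ | j
  · rfl
  · rw [base, base, (h j hj).1]

theorem AgreeBefore.branchPoint_eq (h : p.AgreeBefore p' i) (hj : j ≤ i) (b : Bool) (d : ℕ) :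
    p.branchPoint j b d = p'.branchPoint j b d := by
  rcases d with _ | d
  · exact h.base_eq hj
  · rfl

theorem AgreeBefore.par_eq (h : p.AgreeBefore p' i) {x : ℕ} (hx : x ∈ p.interior i) :
    p.par x = p'.par x := by
  obtain rfl | ⟨j, b, d, rfl, hj⟩ := hx
  · rw [par_rootName, par_rootName]
  · rw [par_nodeName, par_nodeName, h.branchPoint_eq (by omega)]

theorem AgreeBefore.child_mem_verts (h : p.AgreeBefore p' i) (hi : 1 ≤ i) (hil : i ≤ l)
    (hx : p.branchPoint j b d ∈ p.interior i) (hx' : p.branchPoint j b d ∈ p'.interior i)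
    (hy : nodeName j b d ∈ p.verts) : j ≤ i ∧ nodeName j b d ∈ p'.verts := by
  rw [nodeName_mem_verts] at hy ⊢
  rcases d with _ | d
  · rcases j with _ | j
    · exact ⟨Nat.zero_le i, Nat.zero_le l, h.branchLen_eq hi b ▸ hy.2⟩
    · have hlt : j < i := by
        rw [branchPoint, base, nodeName_mem_interior, branchLen_side] at hx
        omega
      exact ⟨hlt, hlt.trans_le hil, p'.one_le_branchLen (Nat.succ_pos j) b⟩
  · rw [branchPoint, nodeName_mem_interior] at hx hx'
    obtain ⟨hji, -⟩ | ⟨rfl, hd⟩ := hx'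
    · exact ⟨hji.le, hy.1, h.branchLen_eq hji b ▸ hy.2⟩
    · exact ⟨le_rfl, hy.1, hd⟩

theorem AgreeBefore.adj (h : p.AgreeBefore p' i) (hi : 1 ≤ i) (hil : i ≤ l) {x y : ℕ}
    (hx : x ∈ p.interior i) (hx' : x ∈ p'.interior i) (hadj : p.tree.tree.Adj x y) :
    p'.tree.tree.Adj x y := by
  have hxv : x ∈ p'.verts := interior_subset_verts hil hx'
  rw [p'.rootedBy.adj_iff]
  obtain ⟨-, hy, ⟨hne, rfl⟩ | ⟨hne, rfl⟩⟩ := (p.rootedBy.adj_iff x y).1 hadj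
  · obtain ⟨j, b, d, rfl⟩ := (eq_rootName_or_nodeName y).resolve_left hne
    rw [par_nodeName] at hx hx' hxv ⊢
    obtain ⟨hj, hy'⟩ := h.child_mem_verts hi hil hx hx' hy
    exact ⟨hxv, hy', Or.inl ⟨hne, by rw [par_nodeName, h.branchPoint_eq hj]⟩⟩
  · rw [h.par_eq hx]
    exact ⟨hxv, p'.par_mem_verts hxv, Or.inr ⟨hne, rfl⟩⟩

theorem AgreeBefore.observe_eq (h : p.AgreeBefore p' i) (hi : 1 ≤ i) (hil : i ≤ l) {m : Move}
    (hx : reached p.tree m ∈ p.interior i) (hx' : reached p.tree m ∈ p'.interior i) :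
    observe p.tree m = observe p'.tree m := by
  have hadj : ∀ y, p.tree.tree.Adj (reached p.tree m) y ↔ p'.tree.tree.Adj (reached p.tree m) y :=
    fun y => ⟨h.adj hi hil hx hx', h.symm.adj hi hil hx' hx⟩
  simp only [observe, reached_tree p' p, hadj]
  rfl

/-! ### The adversary -/

/-- Both branches of stage `i` are occupied. -/
def BothOccupied (i : ℕ) (pos : List ℕ) : Prop :=
  ∀ b, ∃ d, nodeName i b d ∈ pos

/-- Both branches of stage `i` are occupied, or one of them has been followed for the distance
`l`. -/
def StageOver (l i : ℕ) (pos : List ℕ) : Prop :=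
  BothOccupied i pos ∨ ∃ b, nodeName i b (l - 1) ∈ pos

/-- The move `m`, made after the moves `pre`, decides the stage `i`: just before, the side branch is
empty and explored except for its last vertex, and just after, both branches are occupied or the
next branching vertex is reached. -/
structure IsDecidedBy (p : BranchData l) (i : ℕ) (pre : List Move) (m : Move) : Prop where
  side_empty : ∀ d, nodeName i (!p.side i) d ∉ endPos p.tree.home [] pre
  side_visited : ∀ d, d + 1 < p.len i → nodeName i (!p.side i) d ∈ visitedVerts p.tree pre
  side_last_notMem : nodeName i (!p.side i) (p.len i - 1) ∉ visitedVerts p.tree pre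
  occupied : BothOccupied i (endPos p.tree.home [] (pre ++ [m])) ∨
    nodeName i (p.side i) (l - 1) ∈ endPos p.tree.home [] (pre ++ [m])

/-- In the course of the moves `ms`, some move decides the stage `i`. -/
def IsDecided (p : BranchData l) (i : ℕ) (ms : List Move) : Prop :=
  ∃ pre m post, ms = pre ++ m :: post ∧ p.IsDecidedBy i pre m

theorem not_adj_of_branch_ne {c : Bool} {e : ℕ} (hbc : b ≠ c) :
    ¬ p.tree.tree.Adj (nodeName i b d) (nodeName i c e) := by
  have par_ne : ∀ {b c : Bool} {d e : ℕ}, b ≠ c → p.par (nodeName i b d) ≠ nodeName i c e := by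
    intro b c d e hbc hpar
    rw [par_nodeName] at hpar
    rcases d with _ | d
    · rcases i with _ | i
      · exact nodeName_ne_rootName _ _ _ hpar.symm
      · exact absurd (nodeName_inj.1 hpar).1 (Nat.lt_succ_self i).ne
    · exact hbc (nodeName_inj.1 hpar).2.1
  intro hadj
  obtain ⟨-, -, ⟨-, hpar⟩ | ⟨-, hpar⟩⟩ := (p.rootedBy.adj_iff _ _).1 hadj
  · exact par_ne hbc.symm hpar
  · exact par_ne hbc hpar

end BranchData

theorem mem_set_of_mem_of_ne {α : Type*} {L : List α} {a : ℕ} {u v x : α} (hu : L[a]? = some u)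
    (hx : x ∈ L) (hne : x ≠ u) : x ∈ L.set a v := by
  obtain ⟨k, hk⟩ := List.mem_iff_getElem?.1 hx
  refine List.mem_iff_getElem?.2 ⟨k, ?_⟩
  rwa [List.getElem?_set_ne]
  rintro rfl
  exact hne (Option.some.inj (hk.symm.trans hu))

theorem exists_minimal_prefix {α : Type*} {P : List α → Prop} {L : List α} (hnil : ¬ P [])
    (hL : P L) : ∃ pre m post, L = pre ++ m :: post ∧ (∀ pre', pre' <+: pre → ¬ P pre') ∧
      P (pre ++ [m]) := by
  induction L generalizing P with
  | nil => exact absurd hL hnil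
  | cons a L ih =>
    by_cases ha : P [a]
    · exact ⟨[], a, L, rfl, fun pre' h => List.prefix_nil.1 h ▸ hnil, ha⟩
    · obtain ⟨pre, m, post, rfl, hmin, hm⟩ := ih (P := fun L => P (a :: L)) ha hL
      refine ⟨a :: pre, m, post, rfl, fun pre' h => ?_, hm⟩
      obtain rfl | ⟨t, rfl, ht⟩ := List.prefix_cons_iff.1 h
      exacts [hnil, hmin t ht]

namespace BranchData

variable {l : ℕ} {p p' : BranchData l} {i j d : ℕ} {b : Bool}

theorem exists_empty_branch {pos : List ℕ} {m : Move} (hlegal : Legal p.tree pos [m])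
    (hpos : ¬ StageOver l i pos) (hover : StageOver l i (endPos p.tree.home pos [m])) :
    ∃ b, (∀ d, nodeName i (!b) d ∉ pos) ∧ (BothOccupied i (endPos p.tree.home pos [m]) ∨
      nodeName i b (l - 1) ∈ endPos p.tree.home pos [m]) := by
  rw [StageOver, not_or, not_exists] at hpos
  by_cases hboth : BothOccupied i (endPos p.tree.home pos [m])
  · obtain ⟨b, hb⟩ := not_forall.1 hpos.1
    exact ⟨!b, fun d hd => hb ⟨d, b.not_not ▸ hd⟩, Or.inl hboth⟩
  obtain ⟨b, hb⟩ := hover.resolve_left hboth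
  refine ⟨b, fun d hd => ?_, Or.inr hb⟩
  cases m with
  | invoke =>
    obtain hmem | hmem := List.mem_append.1 hb
    · exact hpos.2 b hmem
    · exact nodeName_ne_rootName _ _ _ (List.mem_singleton.1 hmem)
  | traverse a v =>
    obtain ⟨⟨u, hu, hadj⟩, -⟩ := hlegal
    obtain hmem | rfl := List.mem_or_eq_of_mem_set hb
    · exact hpos.2 b hmem
    · have hd' : nodeName i (!b) d ∈ pos.set a (nodeName i b (l - 1)) :=
        mem_set_of_mem_of_ne hu hd fun heq =>
          not_adj_of_branch_ne (Bool.not_ne_self b) (heq ▸ hadj)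
      refine hboth fun c => ?_
      obtain rfl | rfl := Bool.eq_or_eq_not c b
      exacts [⟨_, hb⟩, ⟨_, hd'⟩]

theorem AgreeBefore.mem_interior_of_mem_visitedVerts (h : p.AgreeBefore p' i) {ms : List Move}
    (hlegal : Legal p.tree [] ms)
    (hlast : ∀ b, nodeName i b (p'.branchLen i b - 1) ∉ visitedVerts p.tree ms) {x : ℕ}
    (hx : x ∈ visitedVerts p.tree ms) : x ∈ p'.interior i := by
  have notMem_descendants : ∀ b, x ∉ descendants p.par (nodeName i b (p'.branchLen i b - 1)) :=
    fun b hxb => hlast b (p.rootedBy.mem_visitedVerts_of_mem_descendants hlegal hx hxb)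
  obtain rfl | ⟨j, b, d, -, hd, rfl⟩ : x ∈ p.verts := mem_verts_of_mem_visitedVerts hlegal hx
  · exact Set.mem_insert _ _
  rw [nodeName_mem_interior]
  obtain hji | rfl | hij := lt_trichotomy j i
  · exact Or.inl ⟨hji, h.branchLen_eq hji b ▸ hd⟩
  · refine Or.inr ⟨rfl, not_le.1 fun hle => notMem_descendants b ?_⟩
    exact p.nodeName_mem_descendants (Nat.sub_le_of_le_add hle)
  · refine absurd (p.nodeName_mem_descendants_of_lt hij ?_ b d) (notMem_descendants (p.side i))
    have := p.one_le
    have := p'.branchLen_le i (p.side i)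
    omega

theorem exists_first_stageOver {ms : List Move} (h : Explores p.tree ms) (hi : i ≤ l) :
    ∃ pre m post, ms = pre ++ m :: post ∧ (∀ b, nodeName i b (l - 1) ∉ visitedVerts p.tree pre) ∧
      ∃ b, (∀ d, nodeName i (!b) d ∉ endPos p.tree.home [] pre) ∧
        (BothOccupied i (endPos p.tree.home [] (pre ++ [m])) ∨
          nodeName i b (l - 1) ∈ endPos p.tree.home [] (pre ++ [m])) := by
  have hlast : nodeName i (p.side i) (l - 1) ∈ p.verts :=
    p.nodeName_mem_verts.2 ⟨hi, (p.branchLen_side i).symm ▸ Nat.sub_lt p.one_le one_pos⟩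
  obtain ⟨m₁, m₂, rfl, hreach⟩ := exists_append_of_mem_visitedVerts h.1
    (mem_visitedVerts.2 (h.2 _ hlast))
  have hnil : ¬ StageOver l i (endPos p.tree.home [] []) := by
    simp [StageOver, BothOccupied, endPos]
  obtain ⟨pre, m, post, rfl, hmin, hover⟩ := exists_minimal_prefix
    (P := fun ms => StageOver l i (endPos p.tree.home [] ms)) hnil (Or.inr ⟨_, hreach⟩)
  rw [List.append_assoc, List.cons_append, List.append_cons] at h
  have hlegal := legal_append.1 (legal_append.1 h.1).1
  refine ⟨pre, m, post ++ m₂, by simp, fun b hb => ?_, ?_⟩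
  · obtain ⟨m₁, m₂, rfl, hocc⟩ := exists_append_of_mem_visitedVerts hlegal.1 hb
    exact hmin m₁ (List.prefix_append _ _) (Or.inr ⟨b, hocc⟩)
  · rw [endPos_append] at hover ⊢
    exact exists_empty_branch hlegal.2 (hmin pre (List.prefix_refl _)) hover

theorem AgreeBefore.isRun (h : p.AgreeBefore p' i) (hi : 1 ≤ i) (hil : i ≤ l)
    {next : List Event → Option Move} {ms : List Move} {m : Move} (hlegal : Legal p.tree [] ms)
    (hrun : IsRun next p.tree (ms ++ [m]))
    (hlast : ∀ b, nodeName i b (p.branchLen i b - 1) ∉ visitedVerts p.tree ms)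
    (hlast' : ∀ b, nodeName i b (p'.branchLen i b - 1) ∉ visitedVerts p.tree ms) :
    IsRun next p'.tree (ms ++ [m]) := by
  refine hrun.congr fun m' hm' => ?_
  have hvis : reached p.tree m' ∈ visitedVerts p.tree ms := mem_visitedVerts.2 ⟨m', hm', rfl⟩
  have hself : p.AgreeBefore p i := fun _ _ => ⟨rfl, rfl⟩
  exact h.observe_eq hi hil (hself.mem_interior_of_mem_visitedVerts hlegal hlast hvis)
    (h.mem_interior_of_mem_visitedVerts hlegal hlast' hvis)

theorem exists_stage_choice (S : OnlineStrategy) (p : BranchData l) (hi : 1 ≤ i) (hil : i ≤ l) :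
    ∃ σ k, 1 ≤ k ∧ k ≤ l ∧ ∀ p' : BranchData l, p.AgreeBefore p' i → p'.side i = σ →
      p'.len i = k → p'.IsDecided i (S.moves p'.tree) := by
  classical
  have hl := p.one_le
  let r := p.setStage i true l hi hl le_rfl
  have hr : ∀ b, r.branchLen i b = l := by simp [r, branchLen, setStage]
  obtain ⟨pre, m, post, hmoves, hlast, σ, hempty, hocc⟩ :=
    exists_first_stageOver (S.explores_moves r.tree) hil
  rw [List.append_cons] at hmoves
  have hrun : IsRun S.next r.tree (pre ++ [m]) :=
    IsRun.of_append (hmoves ▸ (S.performs_moves r.tree).1)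
  have hlegal : Legal r.tree [] pre :=
    (legal_append.1 (legal_append.1 (hmoves ▸ (S.explores_moves r.tree).1)).1).1
  have hex : ∃ k, nodeName i (!σ) k ∉ visitedVerts r.tree pre := ⟨_, hlast _⟩
  have hlt : Nat.find hex < l := (Nat.find_min' hex (hlast _)).trans_lt (Nat.sub_lt hl one_pos)
  refine ⟨σ, Nat.find hex + 1, Nat.succ_pos _, hlt, fun p' hagree hside hlen => ?_⟩
  have hlast' : ∀ b, nodeName i b (p'.branchLen i b - 1) ∉ visitedVerts r.tree pre := by
    intro b
    rw [branchLen, hside, hlen]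
    split_ifs with hb
    · exact hlast b
    · exact Bool.eq_not.2 hb ▸ Nat.find_spec hex
  obtain ⟨post', hpost⟩ := ((hagree.setStage hi hl le_rfl).isRun hi hil hlegal hrun
    (fun b => (hr b).symm ▸ hlast b) hlast').prefix_of_performs (S.performs_moves p'.tree)
  refine ⟨pre, m, post', by rw [← hpost]; simp, hside ▸ hempty, ?_, ?_, hside ▸ hocc⟩
  all_goals rw [visitedVerts_tree p' r, hside, hlen]
  · exact fun d hd => not_not.1 (Nat.find_min hex (Nat.lt_of_succ_lt_succ hd))
  · exact Nat.find_spec hex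

theorem exists_forall_isDecided (S : OnlineStrategy) (hl : 1 ≤ l) :
    ∃ p : BranchData l, ∀ i, 1 ≤ i → i ≤ l → p.IsDecided i (S.moves p.tree) := by
  suffices h : ∀ n ≤ l, ∃ p : BranchData l, ∀ i, 1 ≤ i → i ≤ n → ∀ p' : BranchData l,
      p.AgreeBefore p' (i + 1) → p'.IsDecided i (S.moves p'.tree) by
    obtain ⟨p, hp⟩ := h l le_rfl
    exact ⟨p, fun i hi hil => hp i hi hil p fun _ _ => ⟨rfl, rfl⟩⟩
  intro n
  induction n with
  | zero =>
    refine fun _ => ⟨⟨fun _ => true, fun i => min i 1, fun i => (min_le_right i 1).trans hl,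
      rfl, fun i hi => le_min hi le_rfl⟩, fun i hi hi' => ?_⟩
    omega
  | succ n ih =>
    intro hn
    obtain ⟨p, hp⟩ := ih (Nat.le_of_succ_le hn)
    obtain ⟨σ, k, hk, hkl, hdec⟩ := exists_stage_choice S p (Nat.succ_pos n) hn
    refine ⟨p.setStage (n + 1) σ k (Nat.succ_pos n) hk hkl, fun i hi hin p' hp' => ?_⟩
    have hbefore : p.AgreeBefore p' (min (i + 1) (n + 1)) := by
      intro j hj
      rw [lt_min_iff] at hj
      simpa [setStage, hj.2.ne] using hp' j hj.1
    obtain hlt | rfl := hin.lt_or_eq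
    · exact hp i hi (Nat.le_of_lt_succ hlt) p' (hbefore.mono (le_min le_rfl hlt))
    · have hstage := hp' (n + 1) (Nat.lt_succ_self _)
      simp only [setStage, Function.update_self] at hstage
      exact hdec p' (hbefore.mono (le_min (Nat.le_succ _) le_rfl)) hstage.1.symm hstage.2.symm

end BranchData

/-! ### Traversals forced by the adversary -/

theorem two_le_agentsIn {D : Set ℕ} {pos : List ℕ} {x y : ℕ} (hx : x ∈ pos) (hy : y ∈ pos)
    (hne : x ≠ y) (hxD : x ∈ D) (hyD : y ∈ D) : 2 ≤ agentsIn D pos := by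
  have hsub : {x} ∪ {y} ⊆ D := by simp [Set.insert_subset_iff, hxD, hyD]
  have h := agentsIn_mono hsub pos
  rw [agentsIn_union (Set.disjoint_singleton.2 hne)] at h
  have hx' : 0 < agentsIn {x} pos := agentsIn_pos_iff.2 ⟨x, hx, rfl⟩
  have hy' : 0 < agentsIn {y} pos := agentsIn_pos_iff.2 ⟨y, hy, rfl⟩
  omega

namespace BranchData

variable {l : ℕ} {p : BranchData l} {i j c d : ℕ} {b : Bool} {pre post ms m₁ m₂ : List Move}
  {m : Move}

/-- The number of traversals by `ms` of the edge that joins `nodeName i b d` to its parent. -/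
noncomputable def edgeCrossings (p : BranchData l) (ms : List Move) (i : ℕ) (b : Bool) (d : ℕ) :
    ℕ :=
  crossings p.tree.home s(nodeName i b d, p.par (nodeName i b d)) [] ms

/-- Every edge of the spine segment of stage `i` is traversed at least twice by `ms`. -/
def SpineCrossedTwice (p : BranchData l) (ms : List Move) (i : ℕ) : Prop :=
  ∀ d < l, 2 ≤ p.edgeCrossings ms i (p.side i) d

theorem agentsIn_descendants_not_side_eq_zero {pos : List ℕ}
    (h : ∀ e, nodeName i (!p.side i) e ∉ pos) (d : ℕ) :
    agentsIn (descendants p.par (nodeName i (!p.side i) d)) pos = 0 := by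
  refine agentsIn_eq_zero_iff.2 fun x hx hxD => ?_
  obtain ⟨e, rfl⟩ := p.exists_eq_nodeName_of_mem_descendants_not_side hxD
  exact h e hx

theorem side_last_mem_verts (p : BranchData l) (hi : 1 ≤ i) (hil : i ≤ l) :
    nodeName i (!p.side i) (p.len i - 1) ∈ p.tree.tree.verts := by
  refine p.nodeName_mem_verts.2 ⟨hil, ?_⟩
  rw [branchLen_not_side]
  exact Nat.sub_lt (p.len_pos i hi) one_pos

theorem IsDecidedBy.side_last_mem_visitedVerts (h : p.IsDecidedBy i pre m) (hi : 1 ≤ i)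
    (hil : i ≤ l) (hex : Explores p.tree (pre ++ m :: post)) :
    nodeName i (!p.side i) (p.len i - 1) ∈ visitedVerts p.tree (m :: post) := by
  have hvis := mem_visitedVerts.2 (hex.2 _ (p.side_last_mem_verts hi hil))
  rw [visitedVerts_append, Finset.mem_union] at hvis
  exact hvis.resolve_left h.side_last_notMem

theorem IsDecidedBy.two_le_crossings (h : p.IsDecidedBy i pre m) (hlegal : Legal p.tree [] pre)
    (hd : d + 1 < p.len i) : 2 ≤ p.edgeCrossings pre i (!p.side i) d :=
  p.rootedBy.two_le_crossings_of_return (nodeName_ne_rootName _ _ _) hlegal rfl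
    (h.side_visited d hd) (self_mem_descendants _ _)
    (agentsIn_descendants_not_side_eq_zero h.side_empty d)

theorem IsDecided.three_le_edgeCrossings (h : p.IsDecided i ms) (hi : 1 ≤ i) (hil : i ≤ l)
    (hex : Explores p.tree ms) (hd : d + 1 < p.len i) :
    3 ≤ p.edgeCrossings ms i (!p.side i) d := by
  obtain ⟨pre, m, post, rfl, h⟩ := h
  obtain ⟨hpre, hpost⟩ := legal_append.1 hex.1
  have htwo := h.two_le_crossings hpre hd
  have hone := p.rootedBy.one_le_crossings_of_visited (nodeName_ne_rootName _ _ _) hpost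
    (agentsIn_descendants_not_side_eq_zero h.side_empty d)
    (h.side_last_mem_visitedVerts hi hil hex) (p.nodeName_mem_descendants (Nat.le_sub_one_of_lt
      ((Nat.lt_succ_self d).trans hd)))
  rw [edgeCrossings] at htwo ⊢
  rw [crossings_append]
  exact add_le_add htwo hone

theorem IsDecided.four_le_edgeCrossings (h : p.IsDecided i ms) (hi : 1 ≤ i) (hil : i ≤ l)
    (hex : Explores p.tree ms) (hd : d + 1 < p.len i)
    (hend : ∀ e, nodeName i (!p.side i) e ∉ endPos p.tree.home [] ms) :
    4 ≤ p.edgeCrossings ms i (!p.side i) d := by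
  obtain ⟨pre, m, post, rfl, h⟩ := h
  obtain ⟨hpre, hpost⟩ := legal_append.1 hex.1
  rw [endPos_append] at hend
  have htwo := h.two_le_crossings hpre hd
  have htwo' := p.rootedBy.two_le_crossings_of_return (nodeName_ne_rootName _ _ _) hpost
    (agentsIn_descendants_not_side_eq_zero h.side_empty d)
    (h.side_last_mem_visitedVerts hi hil hex) (p.nodeName_mem_descendants (Nat.le_sub_one_of_lt
      ((Nat.lt_succ_self d).trans hd))) (agentsIn_descendants_not_side_eq_zero hend d)
  rw [edgeCrossings] at htwo ⊢
  rw [crossings_append]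
  exact add_le_add htwo htwo'

theorem two_le_edgeCrossings_of_two_agents {x y : ℕ} (h : Legal p.tree [] (m₁ ++ m₂))
    (hx : x ∈ endPos p.tree.home [] m₁) (hy : y ∈ endPos p.tree.home [] m₁) (hne : x ≠ y)
    (hxD : x ∈ descendants p.par (nodeName i b d)) (hyD : y ∈ descendants p.par (nodeName i b d)) :
    2 ≤ p.edgeCrossings (m₁ ++ m₂) i b d :=
  (two_le_agentsIn hx hy hne hxD hyD).trans
    (p.rootedBy.agentsIn_le_crossings (nodeName_ne_rootName _ _ _) h)

theorem spineCrossedTwice_of_bothOccupied (h : Legal p.tree [] (m₁ ++ m₂))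
    (hocc : BothOccupied i (endPos p.tree.home [] m₁)) (hji : j < i) :
    p.SpineCrossedTwice (m₁ ++ m₂) j := by
  intro d hd
  obtain ⟨e, he⟩ := hocc true
  obtain ⟨e', he'⟩ := hocc false
  exact two_le_edgeCrossings_of_two_agents h he he' (by simp [nodeName_inj])
    (p.nodeName_mem_descendants_of_lt hji hd _ _) (p.nodeName_mem_descendants_of_lt hji hd _ _)

theorem IsDecidedBy.spineCrossedTwice_of_edgeCrossings_lt (h : p.IsDecidedBy i pre m) (hi : 1 ≤ i)
    (hil : i ≤ l) (hex : Explores p.tree (pre ++ m :: post))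
    (hocc : nodeName i (p.side i) (l - 1) ∈ endPos p.tree.home [] (pre ++ [m])) (hc : c < l)
    (hlt : p.edgeCrossings (pre ++ m :: post) i (p.side i) c < 2) (hji : j < i) :
    p.SpineCrossedTwice (pre ++ m :: post) j := by
  intro d hd
  obtain ⟨m₁, m₂, hm, hlast⟩ := exists_append_of_mem_visitedVerts (legal_append.1 hex.1).2
    (h.side_last_mem_visitedVerts hi hil hex)
  obtain ⟨rfl, -⟩ | ⟨m₁, rfl, rfl⟩ := List.cons_eq_append_iff.1 hm
  · exact absurd hlast (h.side_empty _)
  -- The agent that reached the next branching vertex cannot have returned across the edge `c`.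
  have hbelow : 0 < agentsIn (descendants p.par (nodeName i (p.side i) c))
      (endPos p.tree.home [] (pre ++ m :: m₁)) := by
    rw [Nat.pos_iff_ne_zero]
    intro hzero
    rw [← List.cons_append, ← List.append_assoc] at hex hlt
    have hvis : nodeName i (p.side i) (l - 1) ∈ visitedVerts p.tree (pre ++ m :: m₁) := by
      rw [← List.singleton_append, ← List.append_assoc, visitedVerts_append]
      exact Finset.mem_union_left _ (mem_visitedVerts_of_mem_endPos_nil hocc)
    have htwo := p.rootedBy.two_le_crossings_of_return (nodeName_ne_rootName _ _ _)
      (legal_append.1 hex.1).1 rfl hvis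
      (p.nodeName_mem_descendants (Nat.le_sub_one_of_lt hc)) hzero
    rw [edgeCrossings, crossings_append] at hlt
    omega
  obtain ⟨x, hx, hxc⟩ := agentsIn_pos_iff.1 hbelow
  rw [← endPos_append] at hlast
  rw [← List.cons_append, ← List.append_assoc] at hex ⊢
  exact two_le_edgeCrossings_of_two_agents hex.1 hx hlast
    (fun hne => p.nodeName_not_side_notMem_descendants (hne ▸ hxc))
    (descendants_subset (p.nodeName_mem_descendants_of_lt hji hd _ _) hxc)
    (p.nodeName_mem_descendants_of_lt hji hd _ _)

theorem IsDecided.spineCrossedTwice_or (h : p.IsDecided i ms) (hi : 1 ≤ i) (hil : i ≤ l)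
    (hex : Explores p.tree ms) :
    p.SpineCrossedTwice ms i ∨ ∀ j < i, p.SpineCrossedTwice ms j := by
  obtain ⟨pre, m, post, rfl, h⟩ := h
  refine or_iff_not_imp_left.2 fun hnot j hji => ?_
  rw [SpineCrossedTwice] at hnot
  push Not at hnot
  obtain ⟨c, hc, hlt⟩ := hnot
  rcases h.occupied with hocc | hocc
  · rw [List.append_cons] at hex ⊢
    exact spineCrossedTwice_of_bothOccupied hex.1 hocc hji
  · exact h.spineCrossedTwice_of_edgeCrossings_lt hi hil hex hocc hc hlt hji

theorem exists_forall_ne_spineCrossedTwice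
    (hdec : ∀ i, 1 ≤ i → i ≤ l → p.IsDecided i ms) (hex : Explores p.tree ms) :
    ∃ c, ∀ i, 1 ≤ i → i ≤ l → i ≠ c → p.SpineCrossedTwice ms i := by
  by_contra! h
  obtain ⟨i, hi, hil, -, hnot⟩ := h 0
  obtain ⟨j, hj, hjl, hji, hnot'⟩ := h i
  rcases hji.lt_or_gt with hlt | hgt
  · exact hnot' ((((hdec i hi hil).spineCrossedTwice_or hi hil hex).resolve_left hnot) j hlt)
  · exact hnot ((((hdec j hj hjl).spineCrossedTwice_or hj hjl hex).resolve_left hnot') i hgt)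

end BranchData

/-! ### The distance forced by the adversary -/

namespace BranchData

variable {l : ℕ} {p : BranchData l} {i : ℕ} {b : Bool} {ms : List Move}

/-- The distance traversed by `ms` in the branch `b` of stage `i`. -/
noncomputable def branchCost (p : BranchData l) (ms : List Move) (i : ℕ) (b : Bool) : ℕ :=
  ∑ d ∈ Finset.range (p.branchLen i b), p.edgeCrossings ms i b d

open Classical in
/-- The stages whose side branch holds an agent at the end of the moves `ms`. -/
noncomputable def endingStages (p : BranchData l) (ms : List Move) : Finset ℕ :=
  {i ∈ Finset.Ioc 0 l | ∃ e, nodeName i (!p.side i) e ∈ endPos p.tree.home [] ms}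

theorem mem_endingStages : i ∈ p.endingStages ms ↔
    i ∈ Finset.Ioc 0 l ∧ ∃ e, nodeName i (!p.side i) e ∈ endPos p.tree.home [] ms := by
  simp [endingStages]

theorem mul_le_branchCost {k n : ℕ} (hk : k ≤ p.branchLen i b)
    (h : ∀ d < k, n ≤ p.edgeCrossings ms i b d) : k * n ≤ p.branchCost ms i b := by
  calc k * n = (Finset.range k).card • n := by rw [Finset.card_range, smul_eq_mul]
    _ ≤ ∑ d ∈ Finset.range k, p.edgeCrossings ms i b d :=
      Finset.card_nsmul_le_sum _ _ _ fun d hd => h d (Finset.mem_range.1 hd)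
    _ ≤ p.branchCost ms i b := Finset.sum_le_sum_of_subset (Finset.range_subset_range.2 hk)

theorem sum_branchCost_le_totalDistance (h : Legal p.tree [] ms) :
    (∑ i ∈ Finset.Icc 0 l, ∑ b, p.branchCost ms i b : ℕ) ≤ totalDistance p.tree [] ms := by
  have hinj : Function.Injective fun x : Σ _ : ℕ, Σ _ : Bool, ℕ => nodeName x.1 x.2.1 x.2.2 := by
    rintro ⟨i, b, d⟩ ⟨j, c, e⟩ h
    obtain ⟨rfl, rfl, rfl⟩ := nodeName_inj.1 h
    rfl
  have hle := p.rootedBy.sum_crossings_le_totalDistance (s := (Finset.Icc 0 l).sigma fun i =>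
    Finset.univ.sigma fun b => Finset.range (p.branchLen i b)) hinj.injOn ?_ h
  · simp only [Finset.sum_sigma, show ∀ e, p.tree.weight e = 1 from fun _ => rfl, one_mul] at hle
    exact_mod_cast hle
  · rintro ⟨i, b, d⟩ hx
    simp only [Finset.mem_sigma, Finset.mem_Icc, Finset.mem_univ, Finset.mem_range, zero_le,
      true_and] at hx
    exact ⟨p.nodeName_mem_verts.2 hx, nodeName_ne_rootName _ _ _⟩

theorem mul_card_endingStages_le (h : Legal p.tree [] ms) :
    l * (p.endingStages ms).card ≤ p.branchCost ms 0 (p.side 0) := by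
  refine mul_le_branchCost (p.branchLen_side 0).ge fun d hd => ?_
  rw [Finset.card_eq_sum_ones]
  calc ∑ _i ∈ p.endingStages ms, 1
      ≤ ∑ i ∈ p.endingStages ms,
          agentsIn (Set.range (nodeName i (!p.side i))) (endPos p.tree.home [] ms) := by
        refine Finset.sum_le_sum fun i hi => agentsIn_pos_iff.2 ?_
        obtain ⟨e, he⟩ := (mem_endingStages.1 hi).2
        exact ⟨_, he, e, rfl⟩
    _ ≤ agentsIn (descendants p.par (nodeName 0 (p.side 0) d)) (endPos p.tree.home [] ms) := by
        refine sum_agentsIn_le ?_ ?_ _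
        · rintro i hi _ ⟨e, rfl⟩
          exact p.nodeName_mem_descendants_of_lt
            (Finset.mem_Ioc.1 (mem_endingStages.1 hi).1).1 hd _ _
        · refine fun i j hij => Set.disjoint_left.2 ?_
          rintro _ ⟨e, rfl⟩ ⟨e', h⟩
          exact hij (nodeName_inj.1 h).1.symm
    _ ≤ p.edgeCrossings ms 0 (p.side 0) d := by
        rw [← List.append_nil ms] at h
        simpa only [edgeCrossings, List.append_nil] using
          p.rootedBy.agentsIn_le_crossings (nodeName_ne_rootName _ _ _) h

theorem two_mul_sq_le_sum_spine (hdec : ∀ i, 1 ≤ i → i ≤ l → p.IsDecided i ms)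
    (hex : Explores p.tree ms) :
    2 * l ^ 2 ≤ ∑ i ∈ Finset.Ioc 0 l, p.branchCost ms i (p.side i) + 2 * l := by
  obtain ⟨c, hc⟩ := exists_forall_ne_spineCrossedTwice hdec hex
  have hle : ∀ i ∈ Finset.Ioc 0 l,
      l * 2 ≤ p.branchCost ms i (p.side i) + if i = c then l * 2 else 0 := by
    intro i hi
    obtain ⟨hi, hil⟩ := Finset.mem_Ioc.1 hi
    split_ifs with hic
    · exact Nat.le_add_left _ _
    · exact mul_le_branchCost (p.branchLen_side i).ge (hc i hi hil hic)
  have hsum := Finset.sum_le_sum hle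
  rw [Finset.sum_add_distrib, Finset.sum_ite_eq', Finset.sum_const, Nat.card_Ioc, smul_eq_mul]
    at hsum
  calc 2 * l ^ 2 = (l - 0) * (l * 2) := by rw [Nat.sub_zero]; ring
    _ ≤ _ := hsum
    _ ≤ _ := by gcongr; split_ifs <;> omega

theorem four_mul_len_le (hi : 1 ≤ i) (hil : i ≤ l) (hdec : p.IsDecided i ms)
    (hex : Explores p.tree ms) :
    4 * p.len i ≤
      p.branchCost ms i (!p.side i) + 4 + if i ∈ p.endingStages ms then l else 0 := by
  have hpos := p.len_pos i hi
  have hk : p.len i - 1 ≤ p.branchLen i (!p.side i) := by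
    rw [branchLen_not_side]
    exact Nat.sub_le _ _
  split_ifs with hend
  · have := mul_le_branchCost hk fun d hd =>
      hdec.three_le_edgeCrossings hi hil hex (Nat.add_lt_of_lt_sub hd)
    have := p.len_le i
    omega
  · have hempty : ∀ e, nodeName i (!p.side i) e ∉ endPos p.tree.home [] ms := fun e he =>
      hend (mem_endingStages.2 ⟨Finset.mem_Ioc.2 ⟨hi, hil⟩, e, he⟩)
    have := mul_le_branchCost hk fun d hd =>
      hdec.four_le_edgeCrossings hi hil hex (Nat.add_lt_of_lt_sub hd) hempty
    omega

theorem four_mul_sum_len_le (hdec : ∀ i, 1 ≤ i → i ≤ l → p.IsDecided i ms)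
    (hex : Explores p.tree ms) :
    4 * ∑ i ∈ Finset.Ioc 0 l, p.len i ≤
      ∑ i ∈ Finset.Ioc 0 l, p.branchCost ms i (!p.side i) + 4 * l +
        l * (p.endingStages ms).card := by
  have hsum := Finset.sum_le_sum fun i (hi : i ∈ Finset.Ioc 0 l) =>
    four_mul_len_le (Finset.mem_Ioc.1 hi).1 (Finset.mem_Ioc.1 hi).2
      (hdec i (Finset.mem_Ioc.1 hi).1 (Finset.mem_Ioc.1 hi).2) hex
  have hsub : p.endingStages ms ⊆ Finset.Ioc 0 l :=
    fun _ hi => (mem_endingStages.1 hi).1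
  rw [← Finset.mul_sum, Finset.sum_add_distrib, Finset.sum_add_distrib, Finset.sum_const,
    Nat.card_Ioc, Finset.sum_ite_mem, Finset.inter_eq_right.2 hsub, Finset.sum_const, smul_eq_mul,
    smul_eq_mul, Nat.sub_zero] at hsum
  linarith

theorem le_totalDistance (hdec : ∀ i, 1 ≤ i → i ≤ l → p.IsDecided i ms)
    (hex : Explores p.tree ms) :
    2 * (l : ℝ) ^ 2 + 4 * (∑ i ∈ Finset.Ioc 0 l, p.len i : ℕ) ≤
      totalDistance p.tree [] ms + 6 * l := by
  have hfirst := mul_card_endingStages_le hex.1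
  have hspine := two_mul_sq_le_sum_spine hdec hex
  have hsides := four_mul_sum_len_le hdec hex
  have hbranches : ∀ i, ∑ b, p.branchCost ms i b =
      p.branchCost ms i (p.side i) + p.branchCost ms i (!p.side i) := by
    intro i
    cases p.side i <;> simp [add_comm]
  have htotal := sum_branchCost_le_totalDistance hex.1
  rw [← Finset.sum_Ioc_add_eq_sum_Icc (Nat.zero_le l)] at htotal
  simp only [hbranches, Finset.sum_add_distrib] at htotal
  have hle : 2 * l ^ 2 + 4 * ∑ i ∈ Finset.Ioc 0 l, p.len i ≤
      ∑ i ∈ Finset.Ioc 0 l, p.branchCost ms i (p.side i) +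
        ∑ i ∈ Finset.Ioc 0 l, p.branchCost ms i (!p.side i) +
        (p.branchCost ms 0 (p.side 0) + p.branchCost ms 0 (!p.side 0)) + 6 * l := by
    omega
  calc 2 * (l : ℝ) ^ 2 + 4 * (∑ i ∈ Finset.Ioc 0 l, p.len i : ℕ)
      ≤ (_ : ℕ) + 6 * (l : ℝ) := by exact_mod_cast hle
    _ ≤ _ := by gcongr

end BranchData

/-! ### The optimum on the adversary's trees -/

/-- A single agent can walk from `u` to `v` at distance at most `c` and visit all of `R` on its
way. -/
def HasWalk (T : WTree) (u v : ℕ) (c : ℝ) (R : Set ℕ) : Prop :=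
  ∃ ms, Legal T [u] ms ∧ endPos T.home [u] ms = [v] ∧ numAgents ms = 0 ∧
    totalDistance T [u] ms ≤ c ∧ R ⊆ visitedVerts T ms

namespace HasWalk

variable {T : WTree} {u v w : ℕ} {c c' : ℝ} {R R' : Set ℕ}

theorem refl (u : ℕ) : HasWalk T u u 0 ∅ :=
  ⟨[], trivial, rfl, rfl, le_rfl, Set.empty_subset _⟩

theorem of_adj (h : T.tree.Adj u v) : HasWalk T u v (T.weight s(u, v)) {v} :=
  ⟨[Move.traverse 0 v], ⟨⟨u, rfl, h⟩, trivial⟩, rfl, rfl, by simp [totalDistance],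
    by simp [mem_visitedVerts, reached]⟩

theorem trans (h : HasWalk T u v c R) (h' : HasWalk T v w c' R') :
    HasWalk T u w (c + c') (R ∪ R') := by
  obtain ⟨ms, hlegal, hend, hagents, hdist, hvis⟩ := h
  obtain ⟨ms', hlegal', hend', hagents', hdist', hvis'⟩ := h'
  refine ⟨ms ++ ms', legal_append.2 ⟨hlegal, hend ▸ hlegal'⟩, ?_, ?_, ?_, ?_⟩
  · rw [endPos_append, hend, hend']
  · rw [numAgents_append, hagents, hagents']
  · rw [totalDistance_append, hend]
    exact add_le_add hdist hdist'
  · rw [visitedVerts_append, Finset.coe_union]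
    exact Set.union_subset_union hvis hvis'

theorem mono (h : HasWalk T u v c R) (hc : c ≤ c') (hR : R' ⊆ R) : HasWalk T u v c' R' := by
  obtain ⟨ms, hlegal, hend, hagents, hdist, hvis⟩ := h
  exact ⟨ms, hlegal, hend, hagents, hdist.trans hc, hR.trans hvis⟩

theorem optCost_le {q : ℝ} (hq : 0 ≤ q) (h : HasWalk T T.home v c R)
    (hR : T.tree.verts ⊆ insert T.home R) : optCost q T ≤ q + c := by
  obtain ⟨ms, hlegal, -, hagents, hdist, hvis⟩ := h
  have hex : Explores T (Move.invoke :: ms) := by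
    refine ⟨hlegal, fun x hx => mem_visitedVerts.1 ?_⟩
    rw [visitedVerts_cons, Finset.mem_insert]
    exact (hR hx).imp_right fun hx => hvis hx
  calc optCost q T ≤ cost q T (Move.invoke :: ms) := _root_.optCost_le hq hex
    _ = q + totalDistance T [T.home] ms := by simp [cost, numAgents, totalDistance, hagents]
    _ ≤ q + c := by gcongr

end HasWalk

namespace BranchData

variable {l : ℕ} (p : BranchData l) {i k d : ℕ} {b : Bool}

theorem branchPoint_adj (hi : i ≤ l) (hd : d < p.branchLen i b) :
    p.tree.tree.Adj (p.branchPoint i b d) (p.branchPoint i b (d + 1)) := by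
  rw [← par_nodeName]
  exact p.rootedBy.par_adj (p.nodeName_mem_verts.2 ⟨hi, hd⟩) (nodeName_ne_rootName _ _ _)

theorem hasWalk_down (hi : i ≤ l) (hk : k ≤ p.branchLen i b) :
    HasWalk p.tree (p.base i) (p.branchPoint i b k) k (nodeName i b '' Set.Iio k) := by
  induction k with
  | zero => exact (HasWalk.refl _).mono (by simp) (by simp)
  | succ k ih =>
    refine ((ih (Nat.le_of_succ_le hk)).trans (HasWalk.of_adj (p.branchPoint_adj hi hk))).mono
      (Nat.cast_succ k).ge ?_
    rintro _ ⟨d, hd, rfl⟩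
    obtain hd | rfl := (Nat.lt_succ_iff.1 hd).lt_or_eq
    exacts [Or.inl ⟨d, hd, rfl⟩, Or.inr rfl]

theorem hasWalk_up (hi : i ≤ l) (hk : k ≤ p.branchLen i b) :
    HasWalk p.tree (p.branchPoint i b k) (p.base i) k ∅ := by
  induction k with
  | zero => exact (HasWalk.refl _).mono (by simp) (Set.empty_subset _)
  | succ k ih =>
    refine ((HasWalk.of_adj (p.branchPoint_adj hi hk).symm).trans
      (ih (Nat.le_of_succ_le hk))).mono (le_of_eq ?_) (Set.empty_subset _)
    rw [Nat.cast_succ, add_comm]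
    rfl

theorem hasWalk_stage (hi : i ≤ l) :
    HasWalk p.tree (p.base i) (p.base (i + 1)) (2 * p.len i + l)
      {x | ∃ b, ∃ d < p.branchLen i b, nodeName i b d = x} := by
  rw [base_succ]
  refine (((p.hasWalk_down hi (p.branchLen_not_side i).ge).trans
    (p.hasWalk_up hi (p.branchLen_not_side i).ge)).trans
    (p.hasWalk_down hi (p.branchLen_side i).ge)).mono (by linarith) ?_
  rintro _ ⟨b, d, hd, rfl⟩
  rcases eq_or_ne b (p.side i) with rfl | hb
  · exact Or.inr ⟨d, (p.branchLen_side i) ▸ hd, rfl⟩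
  · obtain rfl := Bool.eq_not.2 hb
    exact Or.inl (Or.inl ⟨d, (p.branchLen_not_side i) ▸ hd, rfl⟩)

theorem hasWalk_stages (hk : k ≤ l + 1) :
    HasWalk p.tree rootName (p.base k) (∑ i ∈ Finset.range k, (2 * (p.len i : ℝ) + l))
      {x | ∃ i < k, ∃ b, ∃ d < p.branchLen i b, nodeName i b d = x} := by
  induction k with
  | zero => exact (HasWalk.refl _).mono (by simp) (by simp)
  | succ k ih =>
    refine ((ih (Nat.le_of_succ_le hk)).trans (p.hasWalk_stage (Nat.le_of_lt_succ hk))).mono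
      (Finset.sum_range_succ _ _).ge ?_
    rintro x ⟨i, hi, h⟩
    obtain hi | rfl := (Nat.lt_succ_iff.1 hi).lt_or_eq
    exacts [Or.inl ⟨i, hi, h⟩, Or.inr h]

theorem optCost_tree_le {q : ℝ} (hq : 0 ≤ q) :
    optCost q p.tree ≤ q + ((l + 1) * l + 2 * (∑ i ∈ Finset.Ioc 0 l, p.len i : ℕ)) := by
  refine ((p.hasWalk_stages le_rfl).optCost_le hq ?_).trans_eq ?_
  · rintro x (rfl | ⟨i, b, d, hi, hd, rfl⟩)
    exacts [Or.inl rfl, Or.inr ⟨i, Nat.lt_succ_of_le hi, b, d, hd, rfl⟩]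
  · have hlen : ∑ i ∈ Finset.range (l + 1), p.len i = ∑ i ∈ Finset.Ioc 0 l, p.len i := by
      rw [Nat.range_succ_eq_Icc_zero, ← Finset.sum_Ioc_add_eq_sum_Icc (Nat.zero_le l), p.len_zero,
        Nat.add_zero]
    rw [Finset.sum_add_distrib, ← Finset.mul_sum, ← Nat.cast_sum, hlen, Finset.sum_const,
      Finset.card_range, nsmul_eq_mul, Nat.cast_succ]
    ring

theorem optCost_tree_pos {q : ℝ} (hq : 0 ≤ q) : 0 < optCost q p.tree := by
  obtain ⟨ms, hex⟩ := exists_explores p.tree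
  refine lt_of_lt_of_le (add_pos_of_nonneg_of_pos hq ?_) (p.rootedBy.le_optCost hq hex)
  refine p.rootedBy.totalWeight_pos (p.nodeName_mem_verts.2 ⟨Nat.zero_le l, ?_⟩)
    (nodeName_ne_rootName 0 (p.side 0) 0)
  exact (p.branchLen_side 0).symm ▸ p.one_le

end BranchData

/-! ### The adversary's trees are spine trees -/

namespace BranchData

variable {l : ℕ} (p : BranchData l)

/-- The spine vertex at distance `s` from the homebase. -/
noncomputable def spinePoint : ℕ → ℕ
  | 0 => rootName
  | s + 1 => nodeName (s / l) (p.side (s / l)) (s % l)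

theorem spinePoint_eq (i : ℕ) {d : ℕ} (hd : d < l) :
    p.spinePoint (i * l + d + 1) = nodeName i (p.side i) d := by
  have hdiv : (i * l + d) / l = i := by
    rw [Nat.mul_comm, Nat.mul_add_div p.one_le, Nat.div_eq_of_lt hd, Nat.add_zero]
  rw [spinePoint, hdiv, Nat.mul_comm, Nat.mul_add_mod, Nat.mod_eq_of_lt hd]

theorem spinePoint_mul (i : ℕ) : p.spinePoint (i * l) = p.base i := by
  rcases i with _ | i
  · rw [Nat.zero_mul, spinePoint, base]
  · have := p.one_le
    have h : (i + 1) * l = i * l + (l - 1) + 1 := by rw [Nat.succ_mul]; omega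
    rw [h, p.spinePoint_eq i (by omega), base]

theorem spinePoint_injective : Function.Injective p.spinePoint := by
  rintro (_ | s) (_ | t) h
  · rfl
  · exact absurd h.symm (nodeName_ne_rootName _ _ _)
  · exact absurd h (nodeName_ne_rootName _ _ _)
  · obtain ⟨hdiv, -, hmod⟩ := nodeName_inj.1 h
    rw [← Nat.div_add_mod s l, hdiv, hmod, Nat.div_add_mod]

theorem par_spinePoint (s : ℕ) : p.par (p.spinePoint (s + 1)) = p.spinePoint s := by
  obtain ⟨i, d, hd, rfl⟩ : ∃ i d, d < l ∧ s = i * l + d :=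
    ⟨s / l, s % l, Nat.mod_lt _ p.one_le, (Nat.div_add_mod' s l).symm⟩
  rw [p.spinePoint_eq i hd, par_nodeName]
  rcases d with _ | d
  · exact (p.spinePoint_mul i).symm
  · exact (p.spinePoint_eq i (Nat.lt_of_succ_lt hd)).symm

theorem spinePoint_ne_side (s i d : ℕ) : p.spinePoint s ≠ nodeName i (!p.side i) d := by
  rcases s with _ | s
  · exact (nodeName_ne_rootName _ _ _).symm
  · intro h
    obtain ⟨rfl, h, -⟩ := nodeName_inj.1 h
    exact Bool.not_ne_self _ h.symm

/-- The vertex of the tree of `p` that corresponds to a vertex of the spine graph. -/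
noncomputable def spineName : SpineVertex l (fun i => p.len (i + 1)) → ℕ
  | Sum.inl s => p.spinePoint s
  | Sum.inr ⟨i, j⟩ => nodeName (i + 1) (!p.side (i + 1)) j

theorem spineName_injective : Function.Injective p.spineName := by
  rintro (s | ⟨i, j⟩) (t | ⟨i', j'⟩) h
  · rw [Fin.ext (p.spinePoint_injective h)]
  · exact absurd h (p.spinePoint_ne_side _ _ _)
  · exact absurd h.symm (p.spinePoint_ne_side _ _ _)
  · obtain ⟨hi, -, hj⟩ := nodeName_inj.1 h
    obtain rfl := Fin.ext (Nat.succ_injective hi)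
    obtain rfl := Fin.ext hj
    rfl

theorem spinePoint_mem_verts {s : ℕ} (hs : s ≤ l * (l + 1)) : p.spinePoint s ∈ p.verts := by
  rcases s with _ | s
  · exact p.rootName_mem_verts
  · refine p.nodeName_mem_verts.2 ⟨Nat.lt_succ_iff.1 (Nat.div_lt_of_lt_mul hs), ?_⟩
    rw [branchLen_side]
    exact Nat.mod_lt _ p.one_le

theorem spineName_mem_verts : ∀ x, p.spineName x ∈ p.verts
  | Sum.inl s => p.spinePoint_mem_verts (Nat.lt_succ_iff.1 s.2)
  | Sum.inr ⟨i, j⟩ => p.nodeName_mem_verts.2 ⟨i.2, (p.branchLen_not_side _).symm ▸ j.2⟩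

theorem exists_spineName_eq {x : ℕ} (hx : x ∈ p.verts) : ∃ y, p.spineName y = x := by
  obtain rfl | ⟨i, b, d, hi, hd, rfl⟩ := hx
  · exact ⟨Sum.inl 0, rfl⟩
  rcases eq_or_ne b (p.side i) with rfl | hb
  · rw [branchLen_side] at hd
    have hle : i * l ≤ l * l := Nat.mul_le_mul_right l hi
    exact ⟨Sum.inl ⟨i * l + d + 1, by rw [Nat.mul_succ]; omega⟩, p.spinePoint_eq i hd⟩
  · obtain rfl := Bool.eq_not.2 hb
    rw [branchLen_not_side] at hd
    rcases i with _ | i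
    · rw [p.len_zero] at hd
      exact absurd hd (Nat.not_lt_zero d)
    · exact ⟨Sum.inr ⟨⟨i, hi⟩, ⟨d, hd⟩⟩, rfl⟩

/-- The vertex `x` is the parent of the vertex `y` in the tree of `p`. -/
def IsParent (x y : ℕ) : Prop := y ≠ rootName ∧ p.par y = x

theorem isParent_spinePoint_spinePoint {s t : ℕ} :
    p.IsParent (p.spinePoint s) (p.spinePoint t) ↔ s + 1 = t := by
  rcases t with _ | t
  · exact iff_of_false (fun h => h.1 rfl) (Nat.succ_ne_zero s)
  · rw [IsParent, par_spinePoint, p.spinePoint_injective.eq_iff, Nat.succ_inj, eq_comm]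
    exact and_iff_right (nodeName_ne_rootName _ _ _)

theorem isParent_spinePoint_side {s i j : ℕ} :
    p.IsParent (p.spinePoint s) (nodeName i (!p.side i) j) ↔ s = i * l ∧ j = 0 := by
  rw [IsParent, par_nodeName, and_iff_right (nodeName_ne_rootName _ _ _)]
  rcases j with _ | j
  · rw [branchPoint, ← spinePoint_mul, p.spinePoint_injective.eq_iff, eq_comm]
    exact (and_iff_left rfl).symm
  · exact iff_of_false (p.spinePoint_ne_side s i j).symm fun h => Nat.succ_ne_zero j h.2

theorem isParent_side_side {i j i' j' : ℕ} :
    p.IsParent (nodeName i (!p.side i) j) (nodeName i' (!p.side i') j') ↔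
      i = i' ∧ j + 1 = j' := by
  rw [IsParent, par_nodeName, and_iff_right (nodeName_ne_rootName _ _ _)]
  rcases j' with _ | j'
  · rw [branchPoint, ← spinePoint_mul]
    exact iff_of_false (p.spinePoint_ne_side _ _ _) fun h => Nat.succ_ne_zero j h.2
  · rw [branchPoint, nodeName_inj, Nat.succ_inj]
    exact ⟨fun h => ⟨h.1.symm, h.2.2.symm⟩, by rintro ⟨rfl, rfl⟩; exact ⟨rfl, rfl, rfl⟩⟩

theorem not_isParent_side_spinePoint {i j t : ℕ} :
    ¬ p.IsParent (nodeName i (!p.side i) j) (p.spinePoint t) := by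
  rintro ⟨hne, hpar⟩
  rcases t with _ | t
  · exact hne rfl
  · rw [par_spinePoint] at hpar
    exact p.spinePoint_ne_side t i j hpar

theorem spineGraph_adj_iff (x y : SpineVertex l (fun i => p.len (i + 1))) :
    (spineGraph l fun i => p.len (i + 1)).Adj x y ↔
      p.IsParent (p.spineName x) (p.spineName y) ∨ p.IsParent (p.spineName y) (p.spineName x) := by
  rw [spineGraph, SimpleGraph.fromRel_adj]
  have hne : p.IsParent (p.spineName x) (p.spineName y) ∨
      p.IsParent (p.spineName y) (p.spineName x) → x ≠ y := by
    rintro h rfl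
    obtain ⟨hx, h⟩ := or_self_iff.1 h
    exact (p.rk_par_lt hx).ne (congrArg p.rk h)
  refine (and_congr_right' ?_).trans (and_iff_right_of_imp hne)
  rcases x with s | ⟨i, j⟩ <;> rcases y with t | ⟨i', j'⟩ <;> dsimp only [spineName]
  · rw [isParent_spinePoint_spinePoint, isParent_spinePoint_spinePoint]
  · rw [isParent_spinePoint_side, or_iff_left p.not_isParent_side_spinePoint, or_false]
  · rw [isParent_spinePoint_side, or_iff_right p.not_isParent_side_spinePoint, false_or]
  · rw [isParent_side_side, isParent_side_side, Nat.succ_inj, Nat.succ_inj, Fin.val_inj,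
      Fin.val_inj]

theorem isSpineTree : IsSpineTree l p.tree := by
  refine ⟨p.one_le, fun i => p.len (i + 1), fun i => ⟨p.len_pos _ (Nat.le_add_left 1 i),
    p.len_le _⟩, ?_, fun _ _ => rfl⟩
  let f : SpineVertex l (fun i => p.len (i + 1)) → p.tree.tree.verts :=
    fun x => ⟨p.spineName x, p.spineName_mem_verts x⟩
  have hf : Function.Bijective f := by
    refine ⟨fun x y h => p.spineName_injective (congrArg Subtype.val h), fun x => ?_⟩
    obtain ⟨y, hy⟩ := p.exists_spineName_eq x.2
    exact ⟨y, Subtype.ext hy⟩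
  refine ⟨⟨Equiv.ofBijective f hf, ?_⟩, rfl⟩
  intro x y
  rw [spineGraph_adj_iff]
  change p.tree.tree.Adj (p.spineName x) (p.spineName y) ↔ _
  rw [p.rootedBy.adj_iff]
  exact ⟨fun h => h.2.2, fun h => ⟨p.spineName_mem_verts x, p.spineName_mem_verts y, h⟩⟩

end BranchData

/-! ### The competitive ratio -/

theorem exists_spineTree_le_costOn {q : ℝ} (hq : 0 ≤ q) {ε : ℝ} (hε : 0 < ε) :
    ∃ L : ℕ, ∀ l : ℕ, L ≤ l → ∀ S : OnlineStrategy, ∃ T : WTree, IsSpineTree l T ∧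
      0 < optCost q T ∧ (2 - ε) * optCost q T ≤ S.costOn q T := by
  obtain ⟨L, hL⟩ := exists_nat_ge ((2 * q + 8) / ε)
  refine ⟨max L 1, fun l hLl S => ?_⟩
  have hl : 1 ≤ l := (le_max_right L 1).trans hLl
  have hlε : 2 * q + 8 ≤ l * ε :=
    (div_le_iff₀ hε).1 (hL.trans (by exact_mod_cast (le_max_left L 1).trans hLl))
  obtain ⟨p, hdec⟩ := BranchData.exists_forall_isDecided S hl
  have hopt := p.optCost_tree_pos hq
  refine ⟨p.tree, p.isSpineTree, hopt, ?_⟩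
  have hex := S.explores_moves p.tree
  rcases le_or_gt 2 ε with hε2 | hε2
  · exact (mul_nonpos_of_nonpos_of_nonneg (sub_nonpos.2 hε2) hopt.le).trans
      (cost_nonneg hq hex.1)
  set K := ∑ i ∈ Finset.Ioc 0 l, p.len i
  have hl1 : (1 : ℝ) ≤ l := by exact_mod_cast hl
  have hlower : 2 * (l : ℝ) ^ 2 + 4 * K - 6 * l ≤ S.costOn q p.tree :=
    (sub_le_iff_le_add.2 (p.le_totalDistance hdec hex)).trans
      (le_add_of_nonneg_left (mul_nonneg (Nat.cast_nonneg _) hq))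
  have hlarge : (2 * q + 8) * l ≤ l * ε * l := by gcongr
  have hql : q ≤ q * l := le_mul_of_one_le_right hq hl1
  have hrest : 0 ≤ ε * (q + l + 2 * K) := by positivity
  calc (2 - ε) * optCost q p.tree ≤ (2 - ε) * (q + ((l + 1) * l + 2 * K)) :=
        mul_le_mul_of_nonneg_left (p.optCost_tree_le hq) (sub_nonneg.2 hε2.le)
    _ ≤ 2 * (l : ℝ) ^ 2 + 4 * K - 6 * l := by linarith
    _ ≤ S.costOn q p.tree := hlower

theorem two_le_competitiveRatio {q : ℝ} (hq : 0 ≤ q) (S : OnlineStrategy) :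
    2 ≤ competitiveRatio q S := by
  refine le_of_forall_lt fun c hc => ?_
  obtain ⟨r, rfl⟩ := ENNReal.canLift.prf c hc.ne_top
  have hr : (r : ℝ) < 2 := by exact_mod_cast hc
  obtain ⟨L, hL⟩ := exists_spineTree_le_costOn hq (ε := (2 - r) / 2) (by linarith)
  obtain ⟨T, -, hopt, hT⟩ := hL L le_rfl S
  have hlt : (r : ℝ) < S.costOn q T / optCost q T :=
    (lt_div_iff₀ hopt).2 ((mul_lt_mul_of_pos_right (by linarith) hopt).trans_le hT)
  refine lt_of_lt_of_le ?_ (le_iSup _ T)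
  rw [← ENNReal.ofReal_div_of_pos hopt]
  exact (ENNReal.lt_ofReal_iff_toReal_lt ENNReal.coe_ne_top).2 hlt

theorem mainTheorem2 (q : ℝ) (hq : 0 ≤ q) :
    -- depth-first search without return is an on-line strategy of competitive ratio at most 2
    (∃ next, IsDFSWithoutReturn next) ∧
    (∀ next, IsDFSWithoutReturn next →
      ∃ S : OnlineStrategy, S.next = next ∧ competitiveRatio q S ≤ 2) ∧
    -- spine trees force a ratio arbitrarily close to 2 (or more) on every on-line strategy
    (∀ ε : ℝ, 0 < ε → ∃ L : ℕ, ∀ l : ℕ, L ≤ l → ∀ S : OnlineStrategy,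
      ∃ T : WTree, IsSpineTree l T ∧ (2 - ε) * optCost q T ≤ S.costOn q T) ∧
    -- the optimal on-line competitive ratio is exactly 2
    IsLeast {r : ℝ≥0∞ | ∃ S : OnlineStrategy, competitiveRatio q S = r} 2 := by
  refine ⟨exists_isDFSWithoutReturn, fun next hn => hn.exists_onlineStrategy hq, ?_, ?_, ?_⟩
  · intro ε hε
    obtain ⟨L, hL⟩ := exists_spineTree_le_costOn hq hε
    refine ⟨L, fun l hl S => ?_⟩
    obtain ⟨T, h1, -, h2⟩ := hL l hl S
    exact ⟨T, h1, h2⟩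
  · obtain ⟨next, hn⟩ := exists_isDFSWithoutReturn
    obtain ⟨S, -, hS⟩ := hn.exists_onlineStrategy hq
    exact ⟨S, le_antisymm hS (two_le_competitiveRatio hq S)⟩
  · rintro r ⟨S, rfl⟩
    exact two_le_competitiveRatio hq S
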